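/- Let $\mathbb K$ be a perfect field and let $F\in\mathbb K[[x]][y]$ be monic in $y$ of degree $d>0$, where $\mathbb K$ has characteristic $0$ or greater than $d$. Write $\mathrm{val}$ for the $x$-adic valuation. **Newton polygon, edge data.** The Newton polygon $\mathcal N(H)$ of $H=\sum_i a_i(x)y^i=\sum a_{ij}x^jy^i$ is the lower convex hull of the points $(i,\mathrm{val}(a_i))$ with $a_i\neq0$; its boundary polynomial is $\bar H=\sum_{(i,j)\in\mathcal N(H)}a_{ij}x^jy^i$. A polynomial $H$ over a field $\mathbb L$ is *degenerated* with edge data $(q,m,P,N)$ if $\bar H=c\,\big(P(y^q/x^m)\,x^{m\deg P}\big)^N$ with $c\in\mathbb L^\times$, $q>0$ and $m\ge 0$ coprime, and $P\in\mathbb L[Z]$ monic irreducible, $P(0)\ne0$. The Abhyankar shift of $G=\sum_{i\le n}g_iy^i$ monic of degree $n$ is $G(x,y+c(x))$ with $c=-g_{n-1}/n$. **Algorithm.** Put $\mathbb K_0=\mathbb K$, $N_0=d$, let $H_0=F(x,y+c_0(x))$ be the Abhyankar shift of $F$ and $\pi_0(x,y)=(x,y+c_0(x))$. As long as $H_{k-1}\in\mathbb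 K_{k-1}[[x]][y]$ is degenerated, with edge data $(q_k,m_k,P_k,N_k)$, let $\ell_k=\deg P_k$, $\mathbb K_k=\mathbb K_{k-1}[Z_k]/(P_k)$, let $z_k$ be the class of $Z_k$, let $s_k,t_k$ be the integers with $q_ks_k-m_kt_k=1$, $0\le t_k<q_k$, and put $\sigma_k(x,y)=(z_k^{t_k}x^{q_k},\,x^{m_k}(y+z_k^{s_k}))$. Let $G_k$ be the Weierstrass polynomial of $x^{-q_km_k\ell_kN_k}\,\sigma_k^*H_{k-1}$, let $H_k=G_k(x,y+c_k(x))$ be its Abhyankar shift, $\tau_k(x,y)=(x,y+c_k(x))$, and $\pi_k=\pi_{k-1}\circ\sigma_k\circ\tau_k$. Put $e_k=q_1\cdots q_k$ and $f_k=\ell_1\cdots\ell_k$. **Notation.** Fix $k\ge0$ such that $H_0,\dots,H_{k-1}$ are degenerated, so that $H_k$ is defined. Put $\phi_{-1}=x$ and, for $0\le i\le k$, let $\phi_i\in\mathbb K[[x]][y]$ be the monic irreducible polynomial of degree $e_if_i$ such that $(\pi_i^*\phi_i)(x,0)=0$. For $H\in\mathbb K[[x]][y]$ let $v_k(H)=\mathrm{val}(\pi_k^*H)$,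 and let $\lambda_k(H)\in\mathbb K_k$ be the trailing coefficient with respect to $y$ of $\big(\pi_k^*H/x^{v_k(H)}\big)_{|x=0}$, with $\lambda_k(0)=0$. Let $V=(v_k(\phi_{-1}),\dots,v_k(\phi_k))$, $\Lambda=(\lambda_k(\phi_{-1}),\dots,\lambda_k(\phi_k))$ and $$\mathcal B=\{(b_{-1},\dots,b_k)\in\mathbb N^{k+2} : b_{i-1}<q_i\ell_i,\ i=1,\dots,k\}.$$ Write $\Phi^B=\prod_i\phi_i^{b_i}$, $\Lambda^B=\prod_i\lambda_k(\phi_i)^{b_i}$, and let $F=\sum_{B\in\mathcal B}f_B\Phi^B$, $f_B\in\mathbb K$, be the ($x$-adically convergent) $\Phi$-adic expansion of $F$. For $i\in\mathbb N$ let $$w_i=\min\{\langle B,V\rangle : b_k=i,\ f_B\ne0\}-v_k(F)$$ ($w_i=\infty$ if there is no such $B$), let $\mathcal B(i,w)=\{B\in\mathcal B : b_k=i,\ \langle B,V\rangle=w\}$ and $B_0=(0,\dots,0,N_k)$. **Theorem.** The boundary polynomial of $H_k$ is $$\bar H_k=\sum_{(i,w_i)\in\mathcal N(H_k)}\Big(\sum_{B\in\mathcal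 B(i,\,w_i+v_k(F))}f_B\,\Lambda^{B-B_0}\Big)x^{w_i}y^i .$$ -/

import Mathlib

open scoped Polynomial PowerSeries

universe u

namespace ARNP

noncomputable section

/-! ### Newton polygon, boundary polynomial, edge data

An element of `L[[x]][y]` is a term of type `L⟦X⟧[X]`: the inner variable is `x`, the outer one `y`.
Likewise `L[X][X]` stands for `L[x][y]`. -/

/-- The lower boundary of the convex hull of a set of points of the plane. -/
def lowerConvexHull (A : Set (ℝ × ℝ)) : Set (ℝ × ℝ) :=
  {p | p ∈ convexHull ℝ A ∧ ∀ p' ∈ convexHull ℝ A, p'.1 = p.1 → p.2 ≤ p'.2}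

/-- The Newton polygon of `H = ∑ aᵢ(x) yⁱ`: the lower convex hull of the points `(i, val aᵢ)`,
where `aᵢ ≠ 0`. -/
def newtonPolygon {L : Type u} [Field L] (H : L⟦X⟧[X]) : Set (ℝ × ℝ) :=
  lowerConvexHull {p | ∃ i n : ℕ, (H.coeff i).order = (n : ℕ∞) ∧ p = ((i : ℝ), (n : ℝ))}

/-- The boundary polynomial of `H = ∑ aᵢⱼ xʲ yⁱ`: the sum of the `aᵢⱼ xʲ yⁱ` over the points `(i, j)`
of the Newton polygon. -/
def boundaryPoly {L : Type u} [Field L] (H : L⟦X⟧[X]) : L[X][X] :=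
  ∑ᶠ p ∈ {p : ℕ × ℕ | ((p.1 : ℝ), (p.2 : ℝ)) ∈ newtonPolygon H},
    Polynomial.monomial p.1 (Polynomial.monomial p.2 (PowerSeries.coeff p.2 (H.coeff p.1)))

/-- The quasi-homogeneous polynomial `P(y^q / x^m) x^(m deg P)`. -/
def quasiHom {L : Type u} [Field L] (P : L[X]) (q m : ℕ) : L[X][X] :=
  ∑ j ∈ Finset.range (P.natDegree + 1),
    Polynomial.monomial (q * j) (Polynomial.monomial (m * (P.natDegree - j)) (P.coeff j))

/-- `H` is degenerated over `L` with edge data `(q, m, P, N)`. The condition `P(0) ≠ 0`, that is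
`P ≠ Z`, says that the polygon really is an edge of slope `-m/q` and not a single point. -/
structure IsEdgeData {L : Type u} [Field L] (H : L⟦X⟧[X]) (q m : ℕ) (P : L[X]) (N : ℕ) : Prop where
  q_pos : 0 < q
  coprime : Nat.Coprime q m
  monic : P.Monic
  irreducible : Irreducible P
  coeff_zero : P.coeff 0 ≠ 0
  boundary : ∃ c : L, c ≠ 0 ∧
    boundaryPoly H = Polynomial.C (Polynomial.C c) * quasiHom P q m ^ N

/-! ### The transformations -/

/-- `c(x) = -g_{N-1}(x) / N` for a polynomial `G = ∑ gᵢ(x) yⁱ` of degree `N`. -/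
def shift {L : Type u} [Field L] (G : L⟦X⟧[X]) : L⟦X⟧ :=
  -(PowerSeries.C ((G.natDegree : L)⁻¹) * G.coeff (G.natDegree - 1))

/-- The pull-back `G(x, y) ↦ G(x, y + c(x))`. -/
def tauHom {L : Type u} [Field L] (c : L⟦X⟧) : L⟦X⟧[X] →+* L⟦X⟧[X] :=
  Polynomial.eval₂RingHom Polynomial.C (Polynomial.X + Polynomial.C c)

/-- The Abhyankar shift of `G`. -/
def abhyankar {L : Type u} [Field L] (G : L⟦X⟧[X]) : L⟦X⟧[X] := tauHom (shift G) G

/-- The pull-back `H(x, y) ↦ H(z^t x^q, x^m (y + z^s))`, with coefficients extended along `j`. -/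
def sigmaHom {L L' : Type u} [Field L] [Field L'] (j : L →+* L') (q : ℕ) (hq : q ≠ 0)
    (m s t : ℕ) (z : L') : L⟦X⟧[X] →+* L'⟦X⟧[X] :=
  Polynomial.eval₂RingHom
    (Polynomial.C.comp ((PowerSeries.expand q hq : L'⟦X⟧ →ₐ[L'] L'⟦X⟧).toRingHom.comp
      ((PowerSeries.rescale (z ^ t)).comp (PowerSeries.map j))))
    (Polynomial.C (PowerSeries.X ^ m) *
      (Polynomial.X + Polynomial.C (PowerSeries.C (z ^ s))))

/-! ### The run of the algorithm -/

/-- The state of the Newton-Puiseux algorithm with Abhyankar shifts after `k` iterations. -/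
structure Stage (K : Type u) [Field K] where
  /-- the residue field `K_k` -/
  L : Type u
  [fieldL : Field L]
  /-- the embedding of `K` in `K_k` -/
  ι : K →+* L
  /-- the pull-back `π_k^*` -/
  pi : K⟦X⟧[X] →+* L⟦X⟧[X]
  /-- the current polynomial `H_k` -/
  H : L⟦X⟧[X]
  /-- the integer `q_k` (`1` if `k = 0`) -/
  q : ℕ
  /-- the degree `ℓ_k` of `P_k` (`1` if `k = 0`) -/
  ell : ℕ
  /-- the integer `N_k` -/
  N : ℕ
  /-- `e_k = q_1 ⋯ q_k` -/
  e : ℕ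
  /-- `f_k = ℓ_1 ⋯ ℓ_k` -/
  f : ℕ

attribute [instance] Stage.fieldL

/-- The initial stage: `K_0 = K`, `π_0 = τ_0`, and `H_0` is the Abhyankar shift of `F`. -/
def Stage.init {K : Type u} [Field K] (F : K⟦X⟧[X]) : Stage K where
  L := K
  ι := RingHom.id K
  pi := tauHom (shift F)
  H := abhyankar F
  q := 1
  ell := 1
  N := F.natDegree
  e := 1
  f := 1

/-- The stage that follows `S`, where `(q, m, P, N)` is the edge data of `S.H`, `(s, t)` are the
Bézout cofactors and `G` is the Weierstrass polynomial of the Puiseux transform of `S.H`. The new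
field is `S.L[Z]/(P)`, and `z` is the residue class of `Z`. -/
def Stage.next {K : Type u} [Field K] (S : Stage K) (q : ℕ) (hq : q ≠ 0) (m s t N : ℕ)
    (P : S.L[X]) [Fact (Irreducible P)] (G : (AdjoinRoot P)⟦X⟧[X]) : Stage K where
  L := AdjoinRoot P
  ι := (AdjoinRoot.of P).comp S.ι
  pi := (tauHom (shift G)).comp
    ((sigmaHom (AdjoinRoot.of P) q hq m s t (AdjoinRoot.root P)).comp S.pi)
  H := abhyankar G
  q := q
  ell := P.natDegree
  N := N
  e := S.e * q
  f := S.f * P.natDegree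

/-- One iteration of the algorithm leads from `S` to `T`: `S.H` is degenerated with edge data
`(q, m, P, N)`, `F'` is its Puiseux transform `H(z^t x^q, x^m (y + z^s)) / x^(q m ℓ N)`, and `G` is
the Weierstrass polynomial of `F'`, i.e. `F' = G U` with `U` a unit of `L'[[x, y]] = L'[[x]][[y]]`. -/
def Step {K : Type u} [Field K] (S T : Stage K) : Prop :=
  ∃ (q : ℕ) (hq : q ≠ 0) (m s t N : ℕ) (P : S.L[X]) (_ : Fact (Irreducible P))
    (F' G : (AdjoinRoot P)⟦X⟧[X]) (U : (AdjoinRoot P)⟦X⟧⟦X⟧),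
    IsEdgeData S.H q m P N ∧
    t < q ∧ q * s = m * t + 1 ∧
    sigmaHom (AdjoinRoot.of P) q hq m s t (AdjoinRoot.root P) S.H =
      Polynomial.C (PowerSeries.X ^ (q * m * P.natDegree * N)) * F' ∧
    PowerSeries.IsWeierstrassFactorization (F' : (AdjoinRoot P)⟦X⟧⟦X⟧) G U ∧
    T = S.next q hq m s t N P G

/-- `S 0, …, S k` are the first `k + 1` stages of the algorithm run on `F`. -/
def IsRun {K : Type u} [Field K] (F : K⟦X⟧[X]) (k : ℕ) (S : ℕ → Stage K) : Prop :=
  S 0 = Stage.init F ∧ ∀ i < k, Step (S i) (S (i + 1))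

/-- `φ` is the minimal polynomial `φ_k` attached to the stage `S`: monic, irreducible in `K[[x]][y]`,
of degree `e_k f_k`, and zero at the parametrisation `(μ_k x^(e_k), S_k(x)) = π_k(x, 0)`. -/
structure IsMinimalPoly {K : Type u} [Field K] (S : Stage K) (φ : K⟦X⟧[X]) : Prop where
  monic : φ.Monic
  irreducible : Irreducible φ
  natDegree_eq : φ.natDegree = S.e * S.f
  eval_eq_zero : (S.pi φ).eval 0 = 0

/-! ### The valuation `v_k` and the map `λ_k` -/

/-- The `x`-adic valuation on `L[[x]][y]`. -/
def xval {L : Type u} [Field L] (H : L⟦X⟧[X]) : ℕ∞ := ⨅ i : ℕ, (H.coeff i).order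

/-- `(H / x^n)` at `x = 0`, for `n` at most the `x`-adic valuation of `H`. -/
def xcoeff {L : Type u} [Field L] (n : ℕ) (H : L⟦X⟧[X]) : L[X] :=
  ∑ i ∈ Finset.range (H.natDegree + 1), Polynomial.monomial i (PowerSeries.coeff n (H.coeff i))

/-- `v_k(H) = val(π_k^* H)`. -/
def Stage.v {K : Type u} [Field K] (S : Stage K) (H : K⟦X⟧[X]) : ℕ∞ := xval (S.pi H)

/-- `λ_k(H)`: the trailing coefficient in `y` of `π_k^* H / x^(v_k(H))` at `x = 0`. -/
def Stage.lam {K : Type u} [Field K] (S : Stage K) (H : K⟦X⟧[X]) : S.L :=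
  (xcoeff (S.v H).toNat (S.pi H)).trailingCoeff

/-! ### The `Φ`-adic expansion

Vectors `(b_{-1}, …, b_k)` are functions on `Fin (k + 2)`; position `i` carries `b_{i-1}`. -/

/-- The list `Φ = (φ_{-1}, φ_0, φ_1, …)` with `φ_{-1} = x`, shifted by one. -/
def Phi {K : Type u} [Field K] (φ : ℕ → K⟦X⟧[X]) : ℕ → K⟦X⟧[X]
  | 0 => Polynomial.C PowerSeries.X
  | i + 1 => φ i

/-- `Φ^B`. -/
def phiPow {K : Type u} [Field K] {k : ℕ} (φ : ℕ → K⟦X⟧[X]) (B : Fin (k + 2) → ℕ) : K⟦X⟧[X] :=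
  ∏ i : Fin (k + 2), Phi φ (i : ℕ) ^ B i

/-- The exponents `B = (b_{-1}, …, b_k)` with `b_{i-1} < q_i ℓ_i` for `1 ≤ i ≤ k`. -/
def expSet {K : Type u} [Field K] (S : ℕ → Stage K) (k : ℕ) : Set (Fin (k + 2) → ℕ) :=
  {B | ∀ i : Fin (k + 2), 1 ≤ (i : ℕ) → (i : ℕ) ≤ k → B i < (S i).q * (S i).ell}

/-- `F = ∑_{B ∈ 𝓑} f_B Φ^B`, where the sum, infinite only in the powers of `φ_{-1} = x`, converges
`x`-adically: for all `n`, modulo `xⁿ` only finitely many terms with `b_{-1} < n` remain, and their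
sum is `F`. -/
def IsPhiExpansion {K : Type u} [Field K] (S : ℕ → Stage K) (k : ℕ) (φ : ℕ → K⟦X⟧[X])
    (F : K⟦X⟧[X]) (f : (Fin (k + 2) → ℕ) → K) : Prop :=
  (∀ B, f B ≠ 0 → B ∈ expSet S k) ∧
  ∀ n : ℕ, ∃ T : Finset (Fin (k + 2) → ℕ),
    (∀ B, B ∈ T ↔ f B ≠ 0 ∧ B 0 < n) ∧
    Polynomial.C (PowerSeries.X ^ n) ∣
      F - ∑ B ∈ T, Polynomial.C (PowerSeries.C (f B)) * phiPow φ B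

/-- `⟨B, V⟩` with `V = (v_k(φ_{-1}), …, v_k(φ_k))`. -/
def pairing {K : Type u} [Field K] (S : Stage K) {k : ℕ} (φ : ℕ → K⟦X⟧[X])
    (B : Fin (k + 2) → ℕ) : ℕ∞ :=
  ∑ i : Fin (k + 2), (B i : ℕ∞) * S.v (Phi φ (i : ℕ))

/-- `Λ^B` for an integer vector `B`, with `Λ = (λ_k(φ_{-1}), …, λ_k(φ_k))`. -/
def lamPow {K : Type u} [Field K] (S : Stage K) {k : ℕ} (φ : ℕ → K⟦X⟧[X])
    (B : Fin (k + 2) → ℤ) : S.L :=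
  ∏ i : Fin (k + 2), S.lam (Phi φ (i : ℕ)) ^ B i

/-- `min {⟨B, V⟩ : b_k = i, f_B ≠ 0}`, which is `⊤` if there is no such `B`. -/
def minPairing {K : Type u} [Field K] (S : Stage K) {k : ℕ} (φ : ℕ → K⟦X⟧[X])
    (f : (Fin (k + 2) → ℕ) → K) (i : ℕ) : ℕ∞ :=
  sInf {w | ∃ B : Fin (k + 2) → ℕ, B (Fin.last (k + 1)) = i ∧ f B ≠ 0 ∧ w = pairing S φ B}

/-- `w_i = j`, where `w_i = min {⟨B, V⟩ : b_k = i, f_B ≠ 0} - v_k(F)`. It is written without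
subtraction. -/
def IsWeight {K : Type u} [Field K] (S : Stage K) {k : ℕ} (φ : ℕ → K⟦X⟧[X])
    (F : K⟦X⟧[X]) (f : (Fin (k + 2) → ℕ) → K) (i j : ℕ) : Prop :=
  minPairing S φ f i = (j : ℕ∞) + S.v F

/-- The set `𝓑(i, w)` of the `B ∈ 𝓑` with `b_k = i` and `⟨B, V⟩ = w`. -/
def levelSet {K : Type u} [Field K] (S : ℕ → Stage K) (k : ℕ) (φ : ℕ → K⟦X⟧[X])
    (i : ℕ) (w : ℕ∞) : Set (Fin (k + 2) → ℕ) :=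
  {B | B ∈ expSet S k ∧ B (Fin.last (k + 1)) = i ∧ pairing (S k) φ B = w}

/-- The vector `B_0 = (0, …, 0, N)`. -/
def baseVec (k N : ℕ) : Fin (k + 2) → ℕ := Pi.single (Fin.last (k + 1)) N

end

end ARNP

/-! The Φ-adic expansion is pulled back along π_k and compared with a factorisation of π_k^*F. Three
facts hold at every stage (`Invariant`). First, π_k^*Φ^B = x^⟨B,V⟩ y^(b_k) U_B with U_B(0,0) = Λ^B.
Second, π_k^*F = x^(N_k v_k(φ_k)) H_k U with U(0,0) = λ_k(φ_k)^(N_k) ≠ 0; dividing by this constant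
produces the exponent -B_0. Third, for bounded B with ⟨B,V⟩ and b_k prescribed, the Λ^B are linearly
independent over K, so terms with the same exponents never cancel (`Indep.sum_ne_zero`).

A lattice point (i,j) of the Newton polygon of H_k is minimal for the product order among the
exponents of H_k (`eq_of_le_of_mem_newtonPolygon`). Hence the factor U enters the corresponding
coefficient of π_k^*F only through U(0,0). On the other side, a B with smaller exponents would, by
independence, force a smaller exponent in H_k. So only the level set of (i,j) contributes, and only
through Λ^B (`coeff_eq_sum_of_mem_newtonPolygon`).

The invariants pass to the next stage (`invariant_next`) because σ turns x^v y^b U, U(0,0) = u, into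
x^(qv+mb) times a polynomial whose value at x = 0 is u z^(tv) (y+z^s)^b. Expand a polynomial of
degree less than deg φ_{k+1} = qℓ deg φ_k in powers of φ_k. At y = 0 the terms of least weight
become multiples of distinct powers of z with exponents in a window of length ℓ = deg P, so their
sum is nonzero. For φ_{k+1}, the vanishing on y = 0 forces the leading form to be a multiple of
P(y^q/x^m) x^(mℓ) evaluated at (z^t, y+z^s). This has a simple zero at y = 0, since P is separable
and q ≠ 0 in the field.

Stage 0 is special: H_0 need not be a Weierstrass polynomial, and m = 0 may occur. There the units
do not involve y, which is what the condition `c` of `MonoLead` records. -/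

namespace ARNP

/-! ### Leading forms with respect to x. -/

section Lead

variable {L : Type u} [Field L]

/-- `R` is divisible by `x ^ n`, and `p` is the value of `R / x ^ n` at `x = 0`. -/
def HasLead (R : L⟦X⟧[X]) (n : ℕ) (p : L[X]) : Prop :=
  ∃ R' : L⟦X⟧[X], R = Polynomial.C (PowerSeries.X ^ n) * R' ∧
    R'.map PowerSeries.constantCoeff = p

/-- `R = x ^ v * y ^ b * U` with `U(0, 0) = u`; if `c` holds, `U` does not involve `y`. -/
def MonoLead (c : Prop) (v b : ℕ) (u : L) (R : L⟦X⟧[X]) : Prop :=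
  ∃ U : L⟦X⟧[X], R = Polynomial.C (PowerSeries.X ^ v) * Polynomial.X ^ b * U ∧
    PowerSeries.constantCoeff (U.coeff 0) = u ∧ (c → ∃ a, U = Polynomial.C a)

theorem HasLead.mul {R R' : L⟦X⟧[X]} {n n' : ℕ} {p p' : L[X]} (h : HasLead R n p)
    (h' : HasLead R' n' p') : HasLead (R * R') (n + n') (p * p') := by
  obtain ⟨A, rfl, rfl⟩ := h
  obtain ⟨A', rfl, rfl⟩ := h'
  refine ⟨A * A', ?_, by simp⟩
  rw [pow_add, Polynomial.C_mul]; ring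

theorem HasLead.add {R R' : L⟦X⟧[X]} {n : ℕ} {p p' : L[X]} (h : HasLead R n p)
    (h' : HasLead R' n p') : HasLead (R + R') n (p + p') := by
  obtain ⟨A, rfl, rfl⟩ := h
  obtain ⟨A', rfl, rfl⟩ := h'
  exact ⟨A + A', by ring, by simp⟩

theorem HasLead.zero (n : ℕ) : HasLead (0 : L⟦X⟧[X]) n 0 := ⟨0, by simp, by simp⟩

theorem HasLead.sum {ι : Type*} (T : Finset ι) (R : ι → L⟦X⟧[X]) (n : ℕ) (p : ι → L[X])
    (h : ∀ i ∈ T, HasLead (R i) n (p i)) : HasLead (∑ i ∈ T, R i) n (∑ i ∈ T, p i) := by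
  classical
  induction T using Finset.induction_on with
  | empty => simpa using HasLead.zero n
  | insert a T ha ih =>
    rw [Finset.sum_insert ha, Finset.sum_insert ha]
    exact (h a (by simp)).add (ih fun i hi => h i (by simp [hi]))

theorem HasLead.of_lt {R : L⟦X⟧[X]} {n m : ℕ} {p : L[X]} (h : HasLead R n p) (hm : m < n) :
    HasLead R m 0 := by
  obtain ⟨A, rfl, rfl⟩ := h
  refine ⟨Polynomial.C (PowerSeries.X ^ (n - m)) * A, ?_, ?_⟩
  · rw [← mul_assoc, ← Polynomial.C_mul, ← pow_add, Nat.add_sub_cancel' hm.le]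
  · have : n - m ≠ 0 := by omega
    simp [this]

theorem HasLead.coeff {R : L⟦X⟧[X]} {n : ℕ} {p : L[X]} (h : HasLead R n p) (i : ℕ) :
    PowerSeries.coeff n (R.coeff i) = p.coeff i := by
  obtain ⟨A, rfl, rfl⟩ := h
  rw [Polynomial.coeff_C_mul, PowerSeries.coeff_X_pow_mul', Polynomial.coeff_map]
  simp

theorem HasLead.unique {R : L⟦X⟧[X]} {n : ℕ} {p p' : L[X]} (h : HasLead R n p)
    (h' : HasLead R n p') : p = p' := by
  ext i; rw [← h.coeff, h'.coeff]

theorem HasLead.coeff_zero {R : L⟦X⟧[X]} {n : ℕ} {p : L[X]} (h : HasLead R n p)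
    (hR : R.eval 0 = 0) : p.coeff 0 = 0 := by
  rw [← h.coeff, Polynomial.coeff_zero_eq_eval_zero, hR, map_zero]

theorem HasLead.xval {R : L⟦X⟧[X]} {n : ℕ} {p : L[X]} (h : HasLead R n p) (hp : p ≠ 0) :
    xval R = n := by
  apply le_antisymm
  · obtain ⟨i, hi⟩ : ∃ i, p.coeff i ≠ 0 := by
      by_contra! h0
      exact hp (Polynomial.ext (by simpa using h0))
    refine (iInf_le _ i).trans (PowerSeries.order_le n ?_)
    rwa [h.coeff]
  · refine le_iInf fun i => PowerSeries.le_order _ _ fun j hj => ?_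
    have := (h.of_lt (m := j) (by exact_mod_cast hj)).coeff i
    simpa using this

theorem coeff_xcoeff (n : ℕ) (R : L⟦X⟧[X]) (i : ℕ) :
    (xcoeff n R).coeff i = PowerSeries.coeff n (R.coeff i) := by
  unfold xcoeff
  rw [Polynomial.finsetSum_coeff]
  simp only [Polynomial.coeff_monomial]
  rw [Finset.sum_ite_eq']
  split_ifs with h
  · rfl
  · rw [Polynomial.coeff_eq_zero_of_natDegree_lt (by simpa using h), map_zero]

theorem HasLead.xcoeff {R : L⟦X⟧[X]} {n : ℕ} {p : L[X]} (h : HasLead R n p) :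
    xcoeff n R = p := by
  ext i; rw [coeff_xcoeff, h.coeff]

theorem MonoLead.mul {c : Prop} {v v' b b' : ℕ} {u u' : L} {R R' : L⟦X⟧[X]}
    (h : MonoLead c v b u R) (h' : MonoLead c v' b' u' R') :
    MonoLead c (v + v') (b + b') (u * u') (R * R') := by
  obtain ⟨A, rfl, rfl, hA⟩ := h
  obtain ⟨A', rfl, rfl, hA'⟩ := h'
  refine ⟨A * A', ?_, by simp [Polynomial.mul_coeff_zero], fun hc => ?_⟩
  · rw [pow_add, pow_add, Polynomial.C_mul]; ring
  · obtain ⟨a, rfl⟩ := hA hc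
    obtain ⟨a', rfl⟩ := hA' hc
    exact ⟨a * a', by simp⟩

theorem MonoLead.one (c : Prop) : MonoLead c 0 0 1 (1 : L⟦X⟧[X]) :=
  ⟨1, by simp, by simp, fun _ => ⟨1, by simp⟩⟩

theorem MonoLead.pow {c : Prop} {v b : ℕ} {u : L} {R : L⟦X⟧[X]}
    (h : MonoLead c v b u R) (n : ℕ) : MonoLead c (n * v) (n * b) (u ^ n) (R ^ n) := by
  induction n with
  | zero => simpa using MonoLead.one c
  | succ n ih => simpa [pow_succ, add_mul] using ih.mul h

theorem MonoLead.prod {ι : Type*} {c : Prop} (T : Finset ι) (v b : ι → ℕ) (u : ι → L)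
    (R : ι → L⟦X⟧[X]) (h : ∀ i ∈ T, MonoLead c (v i) (b i) (u i) (R i)) :
    MonoLead c (∑ i ∈ T, v i) (∑ i ∈ T, b i) (∏ i ∈ T, u i) (∏ i ∈ T, R i) := by
  classical
  induction T using Finset.induction_on with
  | empty => simpa using MonoLead.one c
  | insert a T ha ih =>
    rw [Finset.sum_insert ha, Finset.sum_insert ha, Finset.prod_insert ha, Finset.prod_insert ha]
    exact (h a (by simp)).mul (ih fun i hi => h i (by simp [hi]))

theorem MonoLead.hasLead {c : Prop} {v b : ℕ} {u : L} {R : L⟦X⟧[X]} (h : MonoLead c v b u R) :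
    ∃ p : L[X], p.coeff 0 = u ∧ HasLead R v (Polynomial.X ^ b * p) := by
  obtain ⟨A, rfl, rfl, -⟩ := h
  exact ⟨A.map PowerSeries.constantCoeff, by simp, Polynomial.X ^ b * A, by ring, by simp⟩

theorem MonoLead.coeff {c : Prop} {v b : ℕ} {u : L} {R : L⟦X⟧[X]} (h : MonoLead c v b u R) :
    PowerSeries.coeff v (R.coeff b) = u := by
  obtain ⟨p, hp, hl⟩ := h.hasLead
  rw [hl.coeff, Polynomial.coeff_X_pow_mul', ← hp]; simp

theorem MonoLead.le_of_coeff_ne_zero {c : Prop} {v b : ℕ} {u : L} {R : L⟦X⟧[X]}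
    (h : MonoLead c v b u R) {i j : ℕ} (hij : PowerSeries.coeff j (R.coeff i) ≠ 0) :
    v ≤ j ∧ b ≤ i ∧ (c → b = i) := by
  obtain ⟨A, rfl, rfl, hA⟩ := h
  rw [mul_assoc, Polynomial.coeff_C_mul, PowerSeries.coeff_X_pow_mul',
    Polynomial.coeff_X_pow_mul'] at hij
  split_ifs at hij with h1 h2
  · refine ⟨h1, h2, fun hc => ?_⟩
    obtain ⟨a, rfl⟩ := hA hc
    by_contra hne
    exact hij (by rw [Polynomial.coeff_C_of_ne_zero (by omega), map_zero])
  · simp at hij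
  · simp at hij

theorem MonoLead.xval {c : Prop} {v b : ℕ} {u : L} {R : L⟦X⟧[X]} (h : MonoLead c v b u R)
    (hu : u ≠ 0) : xval R = v := by
  obtain ⟨p, rfl, hl⟩ := h.hasLead
  refine hl.xval (mul_ne_zero (by simp) ?_)
  rintro rfl; simp at hu

/-- At x = 0 the quotient by x^v is y^b U(0,y), and U(0,0) = u ≠ 0 makes u its lowest coefficient.
This identifies u with the value of λ_k. -/
theorem MonoLead.trailingCoeff_xcoeff {c : Prop} {v b : ℕ} {u : L} {R : L⟦X⟧[X]}
    (h : MonoLead c v b u R) (hu : u ≠ 0) : (xcoeff v R).trailingCoeff = u := by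
  obtain ⟨p, rfl, hl⟩ := h.hasLead
  rw [hl.xcoeff, mul_comm, Polynomial.trailingCoeff_mul,
    ← one_mul (Polynomial.X ^ b), ← Polynomial.C_1, Polynomial.C_mul_X_pow_eq_monomial,
    Polynomial.trailingCoeff, Polynomial.trailingCoeff, Polynomial.natTrailingDegree_monomial one_ne_zero,
    Polynomial.natTrailingDegree_eq_zero.2 (Or.inr hu)]
  simp

theorem HasLead.monoLead_zero {R : L⟦X⟧[X]} {n : ℕ} {p : L[X]} (h : HasLead R n p) :
    MonoLead False n 0 (p.coeff 0) R := by
  obtain ⟨A, rfl, rfl⟩ := h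
  exact ⟨A, by simp, by simp, False.elim⟩

/-- Vanishing on y = 0 survives division by x^n, so y can be split off. -/
theorem HasLead.monoLead_one {R : L⟦X⟧[X]} {n : ℕ} {p : L[X]} (h : HasLead R n p)
    (hR : R.eval 0 = 0) : MonoLead False n 1 (p.coeff 1) R := by
  obtain ⟨A, rfl, rfl⟩ := h
  have hA : A.coeff 0 = 0 := by
    rw [Polynomial.coeff_zero_eq_eval_zero]
    simpa using hR
  obtain ⟨B, rfl⟩ := Polynomial.X_dvd_iff.2 hA
  refine ⟨B, by ring, ?_, False.elim⟩
  rw [Polynomial.map_mul, Polynomial.map_X, Polynomial.coeff_X_mul, Polynomial.coeff_map]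

end Lead

/-! ### Effect of τ and σ on leading forms. -/

section Transformations

variable {L L' : Type u} [Field L] [Field L']

theorem tauHom_eq_taylor (c : L⟦X⟧) (R : L⟦X⟧[X]) : tauHom c R = Polynomial.taylor c R := rfl

theorem tauHom_C (c a : L⟦X⟧) : tauHom c (Polynomial.C a) = Polynomial.C a := by
  simp [tauHom]

theorem tauHom_map {c : L⟦X⟧} (hc : PowerSeries.constantCoeff c = 0) (R : L⟦X⟧[X]) :
    (tauHom c R).map PowerSeries.constantCoeff = R.map PowerSeries.constantCoeff := by
  rw [tauHom_eq_taylor, Polynomial.taylor_apply, Polynomial.map_comp]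
  simp [hc]

theorem HasLead.tauHom {c : L⟦X⟧} (hc : PowerSeries.constantCoeff c = 0) {R : L⟦X⟧[X]} {n : ℕ}
    {p : L[X]} (h : HasLead R n p) : HasLead (tauHom c R) n p := by
  obtain ⟨A, rfl, rfl⟩ := h
  exact ⟨ARNP.tauHom c A, by rw [map_mul, tauHom_C], tauHom_map hc A⟩

variable (j : L →+* L') (q : ℕ) (hq : q ≠ 0) (m s t : ℕ) (z : L')

theorem sigmaHom_C (a : L⟦X⟧) : sigmaHom j q hq m s t z (Polynomial.C a) =
    Polynomial.C (PowerSeries.expand q hq (PowerSeries.rescale (z ^ t) (PowerSeries.map j a))) := by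
  simp [sigmaHom]

theorem sigmaHom_X : sigmaHom j q hq m s t z Polynomial.X =
    Polynomial.C (PowerSeries.X ^ m) *
      (Polynomial.X + Polynomial.C (PowerSeries.C (z ^ s))) := by
  simp [sigmaHom]

theorem sigmaHom_C_X_pow (v : ℕ) :
    sigmaHom j q hq m s t z (Polynomial.C (PowerSeries.X ^ v)) =
    Polynomial.C (PowerSeries.X ^ (q * v)) * Polynomial.C (PowerSeries.C (z ^ (t * v))) := by
  rw [sigmaHom_C, map_pow, PowerSeries.map_X, map_pow, PowerSeries.rescale_X, mul_pow, map_mul,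
    ← map_pow PowerSeries.C, PowerSeries.expand_C, map_pow (PowerSeries.expand q hq),
    PowerSeries.expand_X, ← pow_mul, Polynomial.C_mul, mul_comm, ← pow_mul]

/-- For m > 0 the image x^m (y + z^s) of y vanishes at x = 0, so only U(0,0) survives. For m = 0
this fails unless U is free of y. -/
theorem sigmaHom_map {U : L⟦X⟧[X]} (h : 0 < m ∨ ∃ a, U = Polynomial.C a) :
    (sigmaHom j q hq m s t z U).map PowerSeries.constantCoeff =
      Polynomial.C (j (PowerSeries.constantCoeff (U.coeff 0))) := by
  have hC : ∀ a : L⟦X⟧, (sigmaHom j q hq m s t z (Polynomial.C a)).map PowerSeries.constantCoeff =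
      Polynomial.C (j (PowerSeries.constantCoeff a)) := by
    intro a
    rw [sigmaHom_C, Polynomial.map_C, PowerSeries.constantCoeff_expand,
      ← PowerSeries.coeff_zero_eq_constantCoeff_apply, PowerSeries.coeff_rescale]
    simp
  rcases h with hm | ⟨a, rfl⟩
  · conv_lhs => rw [← Polynomial.divX_mul_X_add U]
    rw [map_add, map_mul, sigmaHom_X, Polynomial.map_add, hC, Polynomial.map_mul,
      Polynomial.map_mul, Polynomial.map_C]
    simp [hm.ne']
  · rw [hC, Polynomial.coeff_C_zero]

theorem MonoLead.sigmaHom {c : Prop} (hc : 0 < m ∨ c) {v b : ℕ} {u : L} {R : L⟦X⟧[X]}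
    (h : MonoLead c v b u R) : HasLead (sigmaHom j q hq m s t z R) (q * v + m * b)
      (Polynomial.C (j u * z ^ (t * v)) * (Polynomial.X + Polynomial.C (z ^ s)) ^ b) := by
  obtain ⟨A, rfl, rfl, hA⟩ := h
  refine ⟨Polynomial.C (PowerSeries.C (z ^ (t * v))) *
    (Polynomial.X + Polynomial.C (PowerSeries.C (z ^ s))) ^ b * ARNP.sigmaHom j q hq m s t z A, ?_, ?_⟩
  · rw [map_mul, map_mul, sigmaHom_C_X_pow, map_pow (ARNP.sigmaHom j q hq m s t z), sigmaHom_X,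
      mul_pow, pow_add,
      Polynomial.C_mul, pow_mul PowerSeries.X m b, Polynomial.C_pow (n := b)]
    ring
  · rw [Polynomial.map_mul, sigmaHom_map j q hq m s t z (hc.imp_right hA), Polynomial.map_mul,
      Polynomial.map_pow]
    simp only [Polynomial.map_add, Polynomial.map_C, Polynomial.map_X,
      PowerSeries.constantCoeff_C, map_mul]
    ring

end Transformations

/-! ### Weierstrass cofactors and adic expansions. -/

/-- If a polynomial over `L[[x]]` has a Weierstrass polynomial `G`, the cofactor is a polynomial. -/
theorem exists_polynomial_cofactor {L : Type u} [Field L] {F' G : L⟦X⟧[X]} {U : L⟦X⟧⟦X⟧}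
    (h : PowerSeries.IsWeierstrassFactorization (F' : L⟦X⟧⟦X⟧) G U) :
    ∃ Q : L⟦X⟧[X], F' = G * Q ∧ PowerSeries.constantCoeff (Q.coeff 0) ≠ 0 ∧ G.Monic ∧
      G.map PowerSeries.constantCoeff = Polynomial.X ^ G.natDegree := by
  have hmon := h.isDistinguishedAt.monic
  have hmap : G.map PowerSeries.constantCoeff = Polynomial.X ^ G.natDegree := by
    ext i
    rw [Polynomial.coeff_map, Polynomial.coeff_X_pow]
    rcases lt_trichotomy i G.natDegree with hi | hi | hi
    · have := h.isDistinguishedAt.mem hi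
      rw [PowerSeries.maximalIdeal_eq_span_X, Ideal.mem_span_singleton, PowerSeries.X_dvd_iff] at this
      rw [this, if_neg hi.ne]
    · rw [if_pos hi, hi, hmon.coeff_natDegree, map_one]
    · rw [Polynomial.coeff_eq_zero_of_natDegree_lt hi, map_zero, if_neg hi.ne']
  have hdiv := h.isDistinguishedAt.isWeierstrassDivisorAt'
  -- Euclidean division by the monic G and the factorisation F' = G U are two Weierstrass divisions
  -- by G. Uniqueness makes the remainder vanish and identifies U with the quotient.
  have key : (G : L⟦X⟧⟦X⟧) * (U - ((F' /ₘ G : L⟦X⟧[X]) : L⟦X⟧⟦X⟧)) =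
      ((F' %ₘ G : L⟦X⟧[X]) : L⟦X⟧⟦X⟧) := by
    rw [mul_sub, ← h.eq_mul, ← Polynomial.coe_mul, ← Polynomial.coe_sub]
    congr 1
    linear_combination -(Polynomial.modByMonic_add_div F' G)
  have hord := h.isDistinguishedAt.coe_natDegree_eq_order_map (G : L⟦X⟧⟦X⟧) 1
    (by rw [map_one, ← Ideal.ne_top_iff_one]; exact Ideal.IsPrime.ne_top') (mul_one _).symm
  have hdeg : (F' %ₘ G).degree < ((PowerSeries.map (Ideal.Quotient.mk
      (IsLocalRing.maximalIdeal L⟦X⟧)) (G : L⟦X⟧⟦X⟧)).order.toNat : WithBot ℕ) := by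
    rw [← hord, ENat.toNat_natCast, ← Polynomial.degree_eq_natDegree hmon.ne_zero]
    exact Polynomial.degree_modByMonic_lt _ hmon
  obtain ⟨h1, h2⟩ := hdiv.eq_zero_of_mul_eq hdeg key
  refine ⟨F' /ₘ G, ?_, ?_, hmon, hmap⟩
  · have := Polynomial.modByMonic_add_div F' G
    rw [h2, zero_add] at this
    exact this.symm
  · have hu := h.isUnit
    rw [sub_eq_zero.1 h1, PowerSeries.isUnit_iff_constantCoeff] at hu
    have := (PowerSeries.isUnit_iff_constantCoeff.1 hu).ne_zero
    simpa using this

/-- Expansion in powers of a monic polynomial. -/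
theorem exists_adic_expansion {R : Type*} [CommRing R] [Nontrivial R] {φ : R[X]} (hφ : φ.Monic)
    (n : ℕ) (A : R[X]) (hA : A.degree < ((n * φ.natDegree : ℕ) : WithBot ℕ)) :
    ∃ a : ℕ → R[X], (∀ b, (a b).degree < (φ.natDegree : WithBot ℕ)) ∧
      A = ∑ b ∈ Finset.range n, a b * φ ^ b := by
  induction n generalizing A with
  | zero =>
    refine ⟨0, fun b => by simp, ?_⟩
    simpa using hA
  | succ n ih =>
    have hdφ := Polynomial.degree_eq_natDegree hφ.ne_zero
    have hlt : (A /ₘ φ).degree < ((n * φ.natDegree : ℕ) : WithBot ℕ) := by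
      by_cases h : A.degree < φ.degree
      · rw [(Polynomial.divByMonic_eq_zero_iff hφ).2 h, Polynomial.degree_zero]
        exact WithBot.bot_lt_coe _
      · rw [not_lt] at h
        have h1 := Polynomial.degree_add_divByMonic hφ h
        have hA0 : A ≠ 0 := by
          rintro rfl
          rw [Polynomial.degree_zero, le_bot_iff, Polynomial.degree_eq_bot] at h
          exact hφ.ne_zero h
        have hq0 : A /ₘ φ ≠ 0 := by
          rw [Ne, Polynomial.divByMonic_eq_zero_iff hφ, not_lt]; exact h
        rw [Polynomial.degree_eq_natDegree hA0] at h1 hA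
        rw [hdφ, Polynomial.degree_eq_natDegree hq0] at h1
        rw [Polynomial.degree_eq_natDegree hq0]
        norm_cast at *
        rw [add_mul] at hA
        omega
    obtain ⟨a, ha, hsum⟩ := ih _ hlt
    refine ⟨fun b => b.casesOn (A %ₘ φ) a, fun b => ?_, ?_⟩
    · cases b with
      | zero => rw [← hdφ]; exact Polynomial.degree_modByMonic_lt _ hφ
      | succ b => exact ha b
    · rw [Finset.sum_range_succ']
      conv_lhs => rw [← Polynomial.modByMonic_add_div A φ, hsum]
      simp only [pow_zero, mul_one, Finset.mul_sum]
      rw [add_comm]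
      congr 1
      exact Finset.sum_congr rfl fun b _ => by ring

/-! ### Linear independence of leading coefficients. -/

theorem root_ne_zero {L : Type u} [Field L] {P : L[X]} (hP : Irreducible P) (hP0 : P.coeff 0 ≠ 0) :
    AdjoinRoot.root P ≠ 0 := by
  intro h
  rw [← AdjoinRoot.mk_X, AdjoinRoot.mk_eq_zero] at h
  have h1 := (hP.dvd_irreducible_iff_associated Polynomial.irreducible_X).1 h
  exact hP0 (Polynomial.X_dvd_iff.1 h1.symm.dvd)

/-- Powers of a root of `P` with exponents `e` such that `q e = w + b`, `b < q deg P`, are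
linearly independent. -/
theorem eq_zero_of_sum_root_pow {L : Type u} [Field L] {P : L[X]} [Fact (Irreducible P)]
    (hP0 : P.coeff 0 ≠ 0) {q w : ℕ} (hq : 0 < q) (T : Finset ℕ) (e : ℕ → ℕ)
    (he : ∀ b ∈ T, q * e b = w + b) (hT : ∀ b ∈ T, b < q * P.natDegree) (u : ℕ → L)
    (h : ∑ b ∈ T, AdjoinRoot.of P (u b) * AdjoinRoot.root P ^ e b = 0) : ∀ b ∈ T, u b = 0 := by
  rcases T.eq_empty_or_nonempty with rfl | hne
  · simp
  have hP : Irreducible P := Fact.out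
  obtain ⟨b₀, hb₀, hmin⟩ := T.exists_min_image id hne
  simp only [id] at hmin
  have hle : ∀ b ∈ T, e b₀ ≤ e b := fun b hb => by
    have h1 := he b hb
    have h2 := he b₀ hb₀
    have h3 := hmin b hb
    exact Nat.le_of_mul_le_mul_left (by omega) hq
  have hlt : ∀ b ∈ T, e b < e b₀ + P.natDegree := fun b hb => by
    have h1 := he b hb
    have h2 := he b₀ hb₀
    have h3 := hT b hb
    refine lt_of_mul_lt_mul_left (a := q) ?_ hq.le
    rw [mul_add]; omega
  have hinj : ∀ b ∈ T, ∀ b' ∈ T, e b = e b' → b = b' := fun b hb b' hb' hee => by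
    have h1 := he b hb
    have h2 := he b' hb'
    rw [hee] at h1; omega
  -- After division by the least power of the root, the exponents are distinct and less than deg P.
  -- The sum is thus the value at the root of a polynomial of degree less than deg P, which must be
  -- zero.
  set p : L[X] := ∑ b ∈ T, Polynomial.monomial (e b - e b₀) (u b) with hp
  have hpdeg : p.degree < P.degree := by
    rw [Polynomial.degree_eq_natDegree hP.ne_zero, Polynomial.degree_lt_iff_coeff_zero]
    intro i hi
    rw [hp, Polynomial.finsetSum_coeff]
    refine Finset.sum_eq_zero fun b hb => ?_
    rw [Polynomial.coeff_monomial, if_neg]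
    have := hlt b hb
    have := hle b hb
    omega
  have hp0 : p = 0 := by
    refine Polynomial.eq_zero_of_dvd_of_degree_lt ?_ hpdeg
    rw [← AdjoinRoot.mk_eq_zero]
    have hz := pow_ne_zero (e b₀) (root_ne_zero hP hP0)
    refine (mul_eq_zero.1 ?_).resolve_right hz
    rw [hp, map_sum, Finset.sum_mul, ← h]
    refine Finset.sum_congr rfl fun b hb => ?_
    rw [← Polynomial.C_mul_X_pow_eq_monomial, map_mul, map_pow, AdjoinRoot.mk_X, AdjoinRoot.mk_C,
      mul_assoc, ← pow_add, Nat.sub_add_cancel (hle b hb)]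
  intro b hb
  have := congrArg (fun p => p.coeff (e b - e b₀)) hp0
  simp only [hp, Polynomial.finsetSum_coeff, Polynomial.coeff_zero] at this
  rw [Finset.sum_eq_single b] at this
  · simpa using this
  · intro b' hb' hne
    rw [Polynomial.coeff_monomial, if_neg]
    intro hee
    have h1 := hle b hb
    have h2 := hle b' hb'
    exact hne (hinj b' hb' b hb (by omega))
  · exact fun h => absurd hb h

/-- The products `Λ ^ B`, where `B` is bounded by `r` from position one on and `⟨B, V⟩` is a given
number, are linearly independent over `K`. -/
def Indep {K L : Type u} [Field K] [Field L] (ι : K →+* L) (r : ℕ → ℕ) (n : ℕ) (V : ℕ → ℕ)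
    (Λ : ℕ → L) : Prop :=
  ∀ (w : ℕ) (T : Finset (Fin n → ℕ)) (f : (Fin n → ℕ) → K),
    (∀ B ∈ T, ∀ i : Fin n, 1 ≤ (i : ℕ) → B i < r i) →
    (∀ B ∈ T, ∑ i : Fin n, B i * V i = w) →
    ∑ B ∈ T, ι (f B) * ∏ i : Fin n, Λ i ^ B i = 0 → ∀ B ∈ T, f B = 0

/-- With x alone, the value determines the exponent, so a level set has at most one element. -/
theorem Indep.of_one {K L : Type u} [Field K] [Field L] (ι : K →+* L) (r : ℕ → ℕ) {V : ℕ → ℕ}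
    {Λ : ℕ → L} (hV : V 0 ≠ 0) (hΛ : Λ 0 ≠ 0) : Indep ι r 1 V Λ := by
  intro w T f _ hw hsum B hB
  have huniq : ∀ B' ∈ T, B' = B := fun B' hB' => by
    have h1 := (hw B' hB').trans (hw B hB).symm
    simp only [Fin.sum_univ_one] at h1
    ext i
    rw [Subsingleton.elim i 0]
    exact Nat.eq_of_mul_eq_mul_right (Nat.pos_of_ne_zero hV) h1
  have hT : T = {B} := by
    ext B'
    rw [Finset.mem_singleton]
    exact ⟨huniq B', fun h => h ▸ hB⟩
  rw [hT, Finset.sum_singleton, mul_eq_zero] at hsum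
  refine (map_eq_zero ι).1 (hsum.resolve_right ?_)
  simp [hΛ]

/-- On a level set, Λ'^B is Λ^B times a power of z that depends only on the last exponent b.
Independence of these powers over L isolates each b; in a fibre of fixed b the old value is
constant, and the hypothesis applies once Λ_n^b is cancelled. -/
theorem Indep.next {K L : Type u} [Field K] [Field L] {ι : K →+* L} {r : ℕ → ℕ} {n : ℕ}
    {V V' : ℕ → ℕ} {Λ : ℕ → L} (h : Indep ι r n V Λ) (hn : 1 ≤ n) (hΛ : Λ n ≠ 0) {P : L[X]}
    [Fact (Irreducible P)] (hP0 : P.coeff 0 ≠ 0) {q m s t : ℕ} (hq : 0 < q)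
    (hst : q * s = m * t + 1) (hr : r n = q * P.natDegree)
    {Λ' : ℕ → AdjoinRoot P}
    (hV : ∀ i < n, V' i = q * V i) (hVn : V' n = q * V n + m)
    (hΛi : ∀ i < n, Λ' i = AdjoinRoot.of P (Λ i) * AdjoinRoot.root P ^ (t * V i))
    (hΛn : Λ' n = AdjoinRoot.of P (Λ n) * AdjoinRoot.root P ^ (t * V n + s)) :
    Indep ((AdjoinRoot.of P).comp ι) r (n + 1) V' Λ' := by
  classical
  intro w T f hT hw hsum
  have hwe : ∀ B ∈ T, q * (∑ i : Fin n, B i.castSucc * V i) + B (Fin.last n) * (q * V n + m) = w := by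
    intro B hB
    rw [← hw B hB, Fin.sum_univ_castSucc, Fin.val_last, hVn, Finset.mul_sum]
    congr 1
    refine Finset.sum_congr rfl fun i _ => ?_
    rw [Fin.val_castSucc, hV _ i.2]; ring
  have hterm : ∀ B ∈ T, (∏ i : Fin (n + 1), Λ' i ^ B i) =
      AdjoinRoot.of P ((∏ i : Fin n, Λ i ^ B i.castSucc) * Λ n ^ B (Fin.last n)) *
        AdjoinRoot.root P ^ ((t * w + B (Fin.last n)) / q) := by
    intro B hB
    -- The division is exact: with w = q Σ + b (q V_n + m), the relation q s = m t + 1 gives t w + b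
    -- = q (t Σ + b (t V_n + s)).
    have hE : (t * w + B (Fin.last n)) / q =
        (∑ i : Fin n, t * V i * B i.castSucc) + (t * V n + s) * B (Fin.last n) := by
      refine Nat.div_eq_of_eq_mul_right hq ?_
      rw [← hwe B hB]
      have : ∑ i : Fin n, t * V i * B i.castSucc = t * ∑ i : Fin n, B i.castSucc * V i := by
        rw [Finset.mul_sum]; exact Finset.sum_congr rfl fun i _ => by ring
      rw [this]
      linear_combination B (Fin.last n) * hst.symm
    rw [hE, Fin.prod_univ_castSucc, Fin.val_last, hΛn, pow_add _ (∑ i : Fin n, _), map_mul, map_prod,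
      ← Finset.prod_pow_eq_pow_sum, mul_pow, ← pow_mul, map_pow]
    have : (∏ i : Fin n, Λ' (i.castSucc : ℕ) ^ B i.castSucc) =
        (∏ i : Fin n, AdjoinRoot.of P (Λ i ^ B i.castSucc)) *
          ∏ i : Fin n, AdjoinRoot.root P ^ (t * V i * B i.castSucc) := by
      rw [← Finset.prod_mul_distrib]
      refine Finset.prod_congr rfl fun i _ => ?_
      rw [Fin.val_castSucc, hΛi _ i.2, mul_pow, ← pow_mul, map_pow]
    rw [this]; ring
  set lst : (Fin (n + 1) → ℕ) → ℕ := fun B => B (Fin.last n) with hlst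
  set u : ℕ → L := fun b => ∑ B ∈ T with lst B = b,
    ι (f B) * ((∏ i : Fin n, Λ i ^ B i.castSucc) * Λ n ^ b) with hu
  have hu0 : ∀ b ∈ T.image lst, u b = 0 := by
    refine eq_zero_of_sum_root_pow hP0 (w := t * w) hq (T.image lst) (fun b => (t * w + b) / q)
      ?_ ?_ u ?_
    · intro b hb
      obtain ⟨B, hB, rfl⟩ := Finset.mem_image.1 hb
      refine Nat.mul_div_cancel' ⟨t * (∑ i : Fin n, B i.castSucc * V i) +
        (t * V n + s) * B (Fin.last n), ?_⟩
      rw [← hwe B hB]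
      linear_combination B (Fin.last n) * hst.symm
    · intro b hb
      obtain ⟨B, hB, rfl⟩ := Finset.mem_image.1 hb
      have := hT B hB (Fin.last n) (by simpa using hn)
      rwa [Fin.val_last, hr] at this
    · rw [← hsum, ← Finset.sum_fiberwise_of_maps_to (g := lst) (t := T.image lst)
        (fun B hB => Finset.mem_image_of_mem _ hB)]
      refine Finset.sum_congr rfl fun b _ => ?_
      rw [hu, map_sum, Finset.sum_mul]
      refine Finset.sum_congr rfl fun B hB => ?_
      obtain ⟨hBT, rfl⟩ := Finset.mem_filter.1 hB
      rw [hterm B hBT, map_mul, RingHom.comp_apply]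
      ring
  intro B hB
  have hub := hu0 (lst B) (Finset.mem_image_of_mem _ hB)
  set b := lst B with hb
  set T' := T.filter (fun B => lst B = b) with hT'
  -- On the fibre the last coordinate is the constant b, so truncating it is injective and
  -- `Fin.snoc` restores it.
  have hsn : ∀ B' ∈ T', (Fin.snoc (α := fun _ => ℕ) (Fin.init B') b : Fin (n + 1) → ℕ) = B' := by
    intro B' hB'
    rw [← (Finset.mem_filter.1 hB').2]
    exact Fin.snoc_init_self B'
  have hinj : Set.InjOn (Fin.init (α := fun _ => ℕ)) (T' : Set (Fin (n + 1) → ℕ)) := by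
    intro B₁ h₁ B₂ h₂ h12
    rw [← hsn B₁ h₁, ← hsn B₂ h₂, h12]
  have hmem : Fin.init (α := fun _ => ℕ) B ∈ T'.image (Fin.init (α := fun _ => ℕ)) :=
    Finset.mem_image_of_mem _ (Finset.mem_filter.2 ⟨hB, rfl⟩)
  have := h (∑ i : Fin n, B i.castSucc * V i) (T'.image (Fin.init (α := fun _ => ℕ)))
    (fun B' => f (Fin.snoc (α := fun _ => ℕ) B' b)) ?_ ?_ ?_ _ hmem
  · rwa [hsn B (Finset.mem_filter.2 ⟨hB, rfl⟩)] at this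
  · intro B' hB' i hi
    obtain ⟨B₁, h₁, rfl⟩ := Finset.mem_image.1 hB'
    exact hT B₁ (Finset.mem_filter.1 h₁).1 i.castSucc hi
  · intro B' hB'
    obtain ⟨B₁, h₁, rfl⟩ := Finset.mem_image.1 hB'
    have e1 := hwe B₁ (Finset.mem_filter.1 h₁).1
    have e2 := hwe B hB
    have e3 : B₁ (Fin.last n) = B (Fin.last n) := (Finset.mem_filter.1 h₁).2
    rw [e3] at e1
    exact Nat.eq_of_mul_eq_mul_left hq (by simp only [Fin.init]; omega)
  · rw [Finset.sum_image hinj]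
    refine (mul_eq_zero.1 ?_).resolve_right (pow_ne_zero b hΛ)
    rw [Finset.sum_mul, ← hub]
    refine Finset.sum_congr rfl fun B' hB' => ?_
    rw [hsn B' hB', mul_assoc]
    rfl

/-! ### Lattice points of the Newton polygon. -/

section Polygon

variable {L : Type u} [Field L]

theorem convexHull_ge {A : Set (ℝ × ℝ)} {a b w : ℝ} (h : ∀ p ∈ A, w ≤ a * p.2 + b * p.1) :
    ∀ p ∈ convexHull ℝ A, w ≤ a * p.2 + b * p.1 := by
  have hc : Convex ℝ {p : ℝ × ℝ | w ≤ a * p.2 + b * p.1} := by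
    refine convex_halfSpace_ge (f := fun p : ℝ × ℝ => a * p.2 + b * p.1) ⟨?_, ?_⟩ w
    · intro p p'; simp only [Prod.snd_add, Prod.fst_add]; ring
    · intro r p; simp only [Prod.smul_snd, Prod.smul_fst, smul_eq_mul]; ring
  exact fun p hp => convexHull_min h hc hp

/-- The points `(i, val aᵢ)` with `aᵢ ≠ 0`. -/
def vertexSet (H : L⟦X⟧[X]) : Set (ℝ × ℝ) :=
  {p | ∃ i n : ℕ, (H.coeff i).order = (n : ℕ∞) ∧ p = ((i : ℝ), (n : ℝ))}

theorem exists_order_le {a : L⟦X⟧} {j : ℕ} (h : PowerSeries.coeff j a ≠ 0) :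
    ∃ n : ℕ, a.order = n ∧ n ≤ j := by
  have hle := PowerSeries.order_le j h
  obtain ⟨n, hn⟩ := ENat.ne_top_iff_exists.1 (ne_top_of_le_ne_top (ENat.natCast_ne_top j) hle)
  refine ⟨n, hn.symm, ?_⟩
  rw [← hn] at hle
  exact_mod_cast hle

theorem coeff_order_ne_zero {a : L⟦X⟧} {n : ℕ} (h : a.order = n) : PowerSeries.coeff n a ≠ 0 :=
  ((PowerSeries.order_eq_nat).1 h).1

/-- The convex hull lies in the half-plane cut out by the minimum of the linear form. As q > 0,
nothing in the hull lies vertically below a minimiser. -/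
theorem mem_newtonPolygon_of_forall_le {H : L⟦X⟧[X]} {i n q m : ℕ} (hq : 0 < q)
    (hn : (H.coeff i).order = n)
    (hmin : ∀ i' j', PowerSeries.coeff j' (H.coeff i') ≠ 0 → q * n + m * i ≤ q * j' + m * i') :
    ((i : ℝ), (n : ℝ)) ∈ newtonPolygon H := by
  refine ⟨subset_convexHull ℝ _ ⟨i, n, hn, rfl⟩, fun p hp hpi => ?_⟩
  have key : (q * n + m * i : ℝ) ≤ q * p.2 + m * p.1 := by
    refine convexHull_ge ?_ p hp
    rintro _ ⟨i', n', hn', rfl⟩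
    have := hmin i' n' (coeff_order_ne_zero hn')
    push_cast
    exact_mod_cast this
  simp only at hpi
  rw [hpi] at key
  have hq' : (0 : ℝ) < q := by exact_mod_cast hq
  exact le_of_mul_le_mul_left (by linarith) hq'

theorem order_eq_of_mem_newtonPolygon {H : L⟦X⟧[X]} {i j : ℕ}
    (hN : ((i : ℝ), (j : ℝ)) ∈ newtonPolygon H) (h : PowerSeries.coeff j (H.coeff i) ≠ 0) :
    (H.coeff i).order = j := by
  obtain ⟨n, hn, hnj⟩ := exists_order_le h
  have := hN.2 ((i : ℝ), (n : ℝ)) (subset_convexHull ℝ _ ⟨i, n, hn, rfl⟩) rfl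
  have : j ≤ n := Nat.cast_le.1 this
  rw [hn, le_antisymm this hnj]

theorem coeff_boundaryPoly (H : L⟦X⟧[X]) (i j : ℕ) [Decidable (((i : ℝ), (j : ℝ)) ∈ newtonPolygon H)] :
    ((boundaryPoly H).coeff i).coeff j =
      if ((i : ℝ), (j : ℝ)) ∈ newtonPolygon H then PowerSeries.coeff j (H.coeff i) else 0 := by
  let g : L[X][X] →+ L := (Polynomial.lcoeff L j).toAddMonoidHom.comp
    (Polynomial.lcoeff L[X] i).toAddMonoidHom
  change g (boundaryPoly H) = _
  unfold boundaryPoly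
  rw [AddMonoidHom.map_finsum_mem']
  · rw [finsum_mem_def, finsum_eq_single _ (i, j)]
    · simp [Set.indicator_apply, g]
    · rintro ⟨i', j'⟩ hne
      refine Set.indicator_apply_eq_zero.2 fun _ => ?_
      · change ((Polynomial.monomial i' (Polynomial.monomial j'
          (PowerSeries.coeff j' (H.coeff i')))).coeff i).coeff j = 0
        rw [Polynomial.coeff_monomial]
        split_ifs with h
        · rw [Polynomial.coeff_monomial, if_neg]
          rintro rfl
          exact hne (by rw [h])
        · simp
  -- Finite support: a nonzero term in column i must sit at the order of the i-th coefficient.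
  · refine (((Finset.range (H.natDegree + 1)).image
      (fun i => (i, (H.coeff i).order.toNat))).finite_toSet).subset ?_
    rintro ⟨i', j'⟩ ⟨hN, hs⟩
    have hc : PowerSeries.coeff j' (H.coeff i') ≠ 0 := by
      rintro h
      apply hs
      simp [h]
    simp only [Finset.coe_image, Set.mem_image, Finset.mem_coe, Finset.mem_range]
    refine ⟨i', ?_, by rw [order_eq_of_mem_newtonPolygon hN hc]; rfl⟩
    by_contra hlt
    rw [Polynomial.coeff_eq_zero_of_natDegree_lt (by omega)] at hc
    simp at hc

/-- A lattice point of the Newton polygon is minimal among the exponents of `H`. -/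
theorem eq_of_le_of_mem_newtonPolygon {H : L⟦X⟧[X]} (hH : H.Monic) {c : Prop}
    (hc : ¬ c → H.map PowerSeries.constantCoeff = Polynomial.X ^ H.natDegree) {i j i' j' : ℕ}
    (hN : ((i : ℝ), (j : ℝ)) ∈ newtonPolygon H) (h : PowerSeries.coeff j' (H.coeff i') ≠ 0)
    (hi : i' ≤ i) (hj : j' ≤ j) (hci : c → i' = i) : i' = i ∧ j' = j := by
  obtain ⟨n, hn, hnj⟩ := exists_order_le h
  have hmem : ((i' : ℝ), (n : ℝ)) ∈ vertexSet H := ⟨i', n, hn, rfl⟩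
  rcases hi.eq_or_lt with rfl | hlt
  · refine ⟨rfl, ?_⟩
    have := hN.2 _ (subset_convexHull ℝ _ hmem) rfl
    have : j ≤ n := Nat.cast_le.1 this
    omega
  exfalso
  have hnc : ¬ c := fun h => hlt.ne (hci h)
  have hdeg : (i : ℝ) ≤ H.natDegree := by
    have := convexHull_ge (A := vertexSet H) (a := 0) (b := -1) (w := -(H.natDegree : ℝ)) ?_ _ hN.1
    · simp only at this; linarith
    · rintro _ ⟨k, l, hl, rfl⟩
      have hk : k ≤ H.natDegree := Polynomial.le_natDegree_of_ne_zero fun h0 => by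
        rw [h0, PowerSeries.order_zero] at hl
        exact absurd hl (ENat.natCast_ne_top l).symm
      have : (k : ℝ) ≤ H.natDegree := by exact_mod_cast hk
      simp only; linarith
  -- Since H is monic, the segment from (i', n) to (deg H, 0) lies in the hull. At abscissa i > i'
  -- its height is less than n ≤ j unless n = 0, and n = 0 with i' < deg H contradicts H ≡ y^(deg H)
  -- mod x.
  have hlast : ((H.natDegree : ℝ), ((0 : ℕ) : ℝ)) ∈ vertexSet H := by
    refine ⟨H.natDegree, 0, ?_, rfl⟩
    rw [hH.coeff_natDegree, PowerSeries.order_one]; rfl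
  have hltR : (i' : ℝ) < i := by exact_mod_cast hlt
  have hpos : (0 : ℝ) < H.natDegree - i' := by linarith
  have hmid : ((i : ℝ), ((H.natDegree - i) / (H.natDegree - i') * n : ℝ)) ∈
      convexHull ℝ (vertexSet H) := by
    have := (convex_convexHull ℝ (vertexSet H)) (subset_convexHull ℝ _ hmem)
      (subset_convexHull ℝ _ hlast) (a := (H.natDegree - i) / (H.natDegree - i'))
      (b := (i - i') / (H.natDegree - i')) (div_nonneg (by linarith) hpos.le)
      (div_nonneg (by linarith) hpos.le) (by rw [← add_div, div_eq_one_iff_eq hpos.ne']; ring)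
    convert this using 2
    · simp only [Prod.smul_mk, Prod.fst_add, smul_eq_mul]
      field_simp
      ring
    · simp
  have h1 := hN.2 _ hmid rfl
  simp only at h1
  have hnjR : (n : ℝ) ≤ j := by exact_mod_cast hnj.trans hj
  have hn0 : (n : ℝ) ≤ 0 := by
    rw [div_mul_eq_mul_div, le_div_iff₀ hpos] at h1
    nlinarith
  have hn0' : n = 0 := by exact_mod_cast le_antisymm hn0 (Nat.cast_nonneg n)
  have h2 := congrArg (fun p => p.coeff i') (hc hnc)
  simp only [Polynomial.coeff_map, Polynomial.coeff_X_pow] at h2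
  have h3 := coeff_order_ne_zero hn
  rw [hn0', PowerSeries.coeff_zero_eq_constantCoeff_apply, h2, if_neg] at h3
  · exact h3 rfl
  · rintro rfl; simp at hpos

end Polygon

/-! ### Consequences of the edge data. -/

section Edge

variable {L : Type u} [Field L]

theorem quasiHom_monic {P : L[X]} (hP : P.Monic) {q : ℕ} (hq : 0 < q) (m : ℕ) :
    (quasiHom P q m).Monic ∧ (quasiHom P q m).natDegree = q * P.natDegree := by
  have hle : (quasiHom P q m).natDegree ≤ q * P.natDegree := by
    refine Polynomial.natDegree_sum_le_of_forall_le _ _ fun j hj => ?_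
    refine (Polynomial.natDegree_monomial_le _).trans (Nat.mul_le_mul_left q ?_)
    simpa [Nat.lt_succ_iff] using hj
  have hc : (quasiHom P q m).coeff (q * P.natDegree) = 1 := by
    unfold quasiHom
    rw [Polynomial.finsetSum_coeff, Finset.sum_eq_single P.natDegree]
    · simp [hP.coeff_natDegree]
    · intro j _ hne
      rw [Polynomial.coeff_monomial, if_neg]
      intro h
      exact hne (Nat.eq_of_mul_eq_mul_left hq h)
    · simp
  have hmon := Polynomial.monic_of_natDegree_le_of_coeff_eq_one _ hle hc
  refine ⟨hmon, le_antisymm hle (Polynomial.le_natDegree_of_ne_zero ?_)⟩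
  rw [hc]; exact one_ne_zero

/-- All monomials `x ^ j y ^ i` of `B` satisfy `q j + m i = w`. -/
def IsQuasiHomogeneous (q m w : ℕ) (B : L[X][X]) : Prop :=
  ∀ i j, (B.coeff i).coeff j ≠ 0 → q * j + m * i = w

theorem IsQuasiHomogeneous.mul {q m w w' : ℕ} {B B' : L[X][X]} (h : IsQuasiHomogeneous q m w B)
    (h' : IsQuasiHomogeneous q m w' B') : IsQuasiHomogeneous q m (w + w') (B * B') := by
  intro i j hij
  rw [Polynomial.coeff_mul, Polynomial.finsetSum_coeff] at hij
  obtain ⟨a, ha, hne⟩ := Finset.exists_ne_zero_of_sum_ne_zero hij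
  rw [Polynomial.coeff_mul] at hne
  obtain ⟨b, hb, hne⟩ := Finset.exists_ne_zero_of_sum_ne_zero hne
  have h1 := h _ _ (left_ne_zero_of_mul hne)
  have h2 := h' _ _ (right_ne_zero_of_mul hne)
  rw [Finset.HasAntidiagonal.mem_antidiagonal] at ha hb
  rw [← ha, ← hb, ← h1, ← h2]; ring

theorem IsQuasiHomogeneous.pow {q m w : ℕ} {B : L[X][X]} (h : IsQuasiHomogeneous q m w B) (N : ℕ) :
    IsQuasiHomogeneous q m (w * N) (B ^ N) := by
  induction N with
  | zero =>
    intro i j hij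
    rw [pow_zero, Polynomial.coeff_one] at hij
    split_ifs at hij with hi
    · rw [Polynomial.coeff_one] at hij
      split_ifs at hij with hj
      · simp [hi, hj]
      · simp at hij
    · simp at hij
  | succ N ih => rw [pow_succ, mul_add, mul_one]; exact ih.mul h

theorem quasiHom_isQuasiHomogeneous (P : L[X]) (q m : ℕ) :
    IsQuasiHomogeneous q m (q * m * P.natDegree) (quasiHom P q m) := by
  intro i j hij
  unfold quasiHom at hij
  rw [Polynomial.finsetSum_coeff, Polynomial.finsetSum_coeff] at hij
  obtain ⟨a, ha, hne⟩ := Finset.exists_ne_zero_of_sum_ne_zero hij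
  rw [Polynomial.coeff_monomial] at hne
  split_ifs at hne with hi
  · rw [Polynomial.coeff_monomial] at hne
    split_ifs at hne with hj
    · rw [← hi, ← hj]
      obtain ⟨d, hd⟩ := Nat.exists_eq_add_of_le (Nat.lt_succ_iff.1 (Finset.mem_range.1 ha))
      rw [hd, Nat.add_sub_cancel_left]; ring
    · simp at hne
  · simp at hne

theorem IsEdgeData.quasiHomogeneous {H : L⟦X⟧[X]} {q m N : ℕ} {P : L[X]}
    (h : IsEdgeData H q m P N) : IsQuasiHomogeneous q m (q * m * P.natDegree * N) (boundaryPoly H) := by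
  obtain ⟨c, -, hb⟩ := h.boundary
  intro i j hij
  rw [hb, Polynomial.coeff_C_mul, Polynomial.coeff_C_mul] at hij
  exact (quasiHom_isQuasiHomogeneous P q m).pow N i j (right_ne_zero_of_mul hij)

/-- As H is monic, (deg H, 0) lies on the polygon with coefficient 1. Comparison with the leading
term of the monic `quasiHom P q m ^ N` gives the degree and forces c = 1. -/
theorem IsEdgeData.natDegree_eq {H : L⟦X⟧[X]} {q m N : ℕ} {P : L[X]}
    (h : IsEdgeData H q m P N) (hH : H.Monic) :
    H.natDegree = q * P.natDegree * N ∧ boundaryPoly H = quasiHom P q m ^ N := by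
  classical
  obtain ⟨c, hc0, hb⟩ := h.boundary
  obtain ⟨hmon, hdeg⟩ := quasiHom_monic h.monic h.q_pos m
  have hbd : (boundaryPoly H).natDegree = q * P.natDegree * N := by
    rw [hb, Polynomial.natDegree_C_mul (by simpa using hc0), (hmon.natDegree_pow N), hdeg, mul_comm]
  have hord : (H.coeff H.natDegree).order = (0 : ℕ) := by
    rw [hH.coeff_natDegree, PowerSeries.order_one]; rfl
  -- For q = 1, m = 0 the linear form is the ordinate, here 0.
  have hmem := mem_newtonPolygon_of_forall_le (q := 1) (m := 0) one_pos hord (by simp)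
  have hcoef : ((boundaryPoly H).coeff H.natDegree).coeff 0 = 1 := by
    rw [coeff_boundaryPoly, if_pos hmem, hH.coeff_natDegree]; simp
  have hle : H.natDegree ≤ (boundaryPoly H).natDegree := by
    refine Polynomial.le_natDegree_of_ne_zero fun h0 => ?_
    rw [h0] at hcoef; simp at hcoef
  have hge : (boundaryPoly H).natDegree ≤ H.natDegree := by
    rw [Polynomial.natDegree_le_iff_coeff_eq_zero]
    intro i hi
    ext j
    rw [coeff_boundaryPoly, Polynomial.coeff_eq_zero_of_natDegree_lt hi]
    simp
  have hN : H.natDegree = q * P.natDegree * N := by omega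
  refine ⟨hN, ?_⟩
  have hc1 : c = 1 := by
    rw [hb, hN] at hcoef
    have : (quasiHom P q m ^ N).coeff (q * P.natDegree * N) = 1 := by
      have := (hmon.pow N).coeff_natDegree
      rwa [hmon.natDegree_pow, hdeg, mul_comm N] at this
    rw [Polynomial.coeff_C_mul, this] at hcoef
    simpa using hcoef
  rw [hb, hc1]; simp

/-- An exponent of H minimising q j + m i lies on the polygon, hence on the line of the edge. So no
exponent lies below that line. -/
theorem IsEdgeData.le_of_coeff_ne_zero {H : L⟦X⟧[X]} {q m N : ℕ} {P : L[X]}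
    (h : IsEdgeData H q m P N) {i j : ℕ} (hij : PowerSeries.coeff j (H.coeff i) ≠ 0) :
    q * m * P.natDegree * N ≤ q * j + m * i := by
  classical
  have hex : ∃ w i' j', PowerSeries.coeff j' (H.coeff i') ≠ 0 ∧ q * j' + m * i' = w :=
    ⟨_, i, j, hij, rfl⟩
  obtain ⟨i₀, j₀, hne, hw⟩ := Nat.find_spec hex
  have hmin : ∀ i' j', PowerSeries.coeff j' (H.coeff i') ≠ 0 →
      q * j₀ + m * i₀ ≤ q * j' + m * i' := fun i' j' h' => by
    rw [hw]; exact Nat.find_min' hex ⟨i', j', h', rfl⟩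
  have hord : (H.coeff i₀).order = j₀ := by
    obtain ⟨n, hn, hnj⟩ := exists_order_le hne
    have := hmin i₀ n (coeff_order_ne_zero hn)
    have : j₀ ≤ n := Nat.le_of_mul_le_mul_left (by omega) h.q_pos
    rw [hn, le_antisymm this hnj]
  have hmem := mem_newtonPolygon_of_forall_le h.q_pos hord hmin
  rw [← h.quasiHomogeneous i₀ j₀ (by rwa [coeff_boundaryPoly, if_pos hmem])]
  exact hmin i j hij

theorem IsEdgeData.coeff_eq {H : L⟦X⟧[X]} {q m N : ℕ} {P : L[X]}
    (h : IsEdgeData H q m P N) {i j : ℕ} (hij : q * j + m * i = q * m * P.natDegree * N) :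
    PowerSeries.coeff j (H.coeff i) = ((boundaryPoly H).coeff i).coeff j := by
  classical
  rw [coeff_boundaryPoly]
  split_ifs with hmem
  · rfl
  · by_contra hne
    refine hmem ?_
    have hord : (H.coeff i).order = j := by
      obtain ⟨n, hn, hnj⟩ := exists_order_le hne
      have := h.le_of_coeff_ne_zero (coeff_order_ne_zero hn)
      have : j ≤ n := Nat.le_of_mul_le_mul_left (by omega) h.q_pos
      rw [hn, le_antisymm this hnj]
    exact mem_newtonPolygon_of_forall_le h.q_pos hord fun i' j' h' => by
      rw [hij]; exact h.le_of_coeff_ne_zero h'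

/-- If m = 0, the edge is horizontal and H(0,0) = P(0)^N ≠ 0, against H ≡ y^(deg H) mod x. -/
theorem IsEdgeData.m_pos {H : L⟦X⟧[X]} {q m N : ℕ} {P : L[X]}
    (h : IsEdgeData H q m P N) (hH : H.Monic) (hdeg : 0 < H.natDegree)
    (hX : H.map PowerSeries.constantCoeff = Polynomial.X ^ H.natDegree) : 0 < m := by
  rcases Nat.eq_zero_or_pos m with rfl | hm
  · exfalso
    have h1 := h.coeff_eq (i := 0) (j := 0) (by simp)
    have h2 : PowerSeries.coeff 0 (H.coeff 0) = 0 := by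
      rw [PowerSeries.coeff_zero_eq_constantCoeff_apply, ← Polynomial.coeff_map, hX,
        Polynomial.coeff_X_pow, if_neg hdeg.ne]
    rw [h2, (h.natDegree_eq hH).2, Polynomial.coeff_zero_eq_eval_zero,
      Polynomial.coeff_zero_eq_eval_zero, Polynomial.eval_pow, Polynomial.eval_pow] at h1
    have h3 := eq_zero_of_pow_eq_zero h1.symm
    refine h.coeff_zero ?_
    rw [← Polynomial.coeff_zero_eq_eval_zero, ← Polynomial.coeff_zero_eq_eval_zero, quasiHom,
      Polynomial.finsetSum_coeff, Polynomial.finsetSum_coeff, Finset.sum_eq_single 0] at h3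
    · simpa using h3
    · intro j _ hj
      rw [Polynomial.coeff_monomial, if_neg (Nat.mul_ne_zero h.q_pos.ne' hj)]
      simp
    · simp
  · exact hm

end Edge

/-! ### Leading form of the Puiseux transform of H. -/

noncomputable section

/-- The substitution `x ↦ z ^ t`, `y ↦ y + z ^ s` in a polynomial over `L`. -/
def leadHom {L L' : Type u} [Field L] [Field L'] (j : L →+* L') (s t : ℕ) (z : L') :
    L[X][X] →+* L'[X] :=
  Polynomial.eval₂RingHom (Polynomial.C.comp (Polynomial.eval₂RingHom j (z ^ t)))
    (Polynomial.X + Polynomial.C (z ^ s))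

end

theorem exists_monoLead_C_mul_X_pow {L : Type u} [Field L] {a : L⟦X⟧} {n : ℕ}
    (h : ∀ j < n, PowerSeries.coeff j a = 0) (i : ℕ) :
    MonoLead True n i (PowerSeries.coeff n a) (Polynomial.C a * Polynomial.X ^ i) := by
  obtain ⟨b, rfl⟩ := PowerSeries.X_pow_dvd_iff.2 h
  refine ⟨Polynomial.C b, ?_, ?_, fun _ => ⟨b, rfl⟩⟩
  · rw [Polynomial.C_mul]; ring
  · rw [PowerSeries.coeff_X_pow_mul']; simp

theorem leadHom_eq_sum {L L' : Type u} [Field L] [Field L'] (j : L →+* L') (s t : ℕ) (z : L')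
    (B : L[X][X]) {n : ℕ} (hn : B.natDegree < n) : leadHom j s t z B =
      ∑ i ∈ Finset.range n, Polynomial.C ((B.coeff i).eval₂ j (z ^ t)) *
        (Polynomial.X + Polynomial.C (z ^ s)) ^ i := by
  simp only [leadHom, Polynomial.coe_eval₂RingHom]
  rw [Polynomial.eval₂_eq_sum_range' _ hn]
  rfl

theorem leadHom_monomial {L L' : Type u} [Field L] [Field L'] (j : L →+* L') (s t : ℕ) (z : L')
    (i k : ℕ) (a : L) : leadHom j s t z (Polynomial.monomial i (Polynomial.monomial k a)) =
      Polynomial.C (j a * z ^ (t * k)) * (Polynomial.X + Polynomial.C (z ^ s)) ^ i := by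
  simp [leadHom, pow_mul]

theorem IsEdgeData.hasLead_sigmaHom {L L' : Type u} [Field L] [Field L'] {H : L⟦X⟧[X]}
    {q m N : ℕ} {P : L[X]} (h : IsEdgeData H q m P N) (hH : H.Monic) (j : L →+* L') (hq : q ≠ 0)
    (s t : ℕ) (z : L') : HasLead (sigmaHom j q hq m s t z H) (q * m * P.natDegree * N)
      (leadHom j s t z (quasiHom P q m ^ N)) := by
  obtain ⟨hdeg, hb⟩ := h.natDegree_eq hH
  obtain ⟨hmon, hdeg'⟩ := quasiHom_monic h.monic h.q_pos m
  set w := q * m * P.natDegree * N with hw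
  rw [leadHom_eq_sum j s t z (quasiHom P q m ^ N) (n := H.natDegree + 1)
    (by rw [hmon.natDegree_pow, hdeg', hdeg, mul_comm]; omega), ← hb]
  conv => enter [1]; rw [H.as_sum_range_C_mul_X_pow, map_sum]
  refine HasLead.sum _ _ _ _ fun i _ => ?_
  -- `Nat.find hex` is the lowest height in column i on or above the edge line. The column
  -- contributes to the leading form exactly when this height lies on the line.
  have hex : ∃ k, w ≤ q * k + m * i := ⟨w, by nlinarith [h.q_pos]⟩
  have hlow : ∀ k < Nat.find hex, PowerSeries.coeff k (H.coeff i) = 0 := fun k hk => by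
    by_contra hne
    exact Nat.find_min hex hk (h.le_of_coeff_ne_zero hne)
  have hlead := (exists_monoLead_C_mul_X_pow hlow i).sigmaHom j q hq m s t z (Or.inr trivial)
  rcases (Nat.find_spec hex).eq_or_lt with heq | hlt
  · rw [← heq] at hlead
    convert hlead using 3
    have : (boundaryPoly H).coeff i =
        Polynomial.monomial (Nat.find hex) (PowerSeries.coeff (Nat.find hex) (H.coeff i)) := by
      ext k
      rw [Polynomial.coeff_monomial]
      split_ifs with hk
      · rw [← hk, h.coeff_eq heq.symm]
      · by_contra hne
        have h1 := h.quasiHomogeneous i k hne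
        exact hk (Nat.eq_of_mul_eq_mul_left h.q_pos (by omega))
    rw [this, Polynomial.eval₂_monomial, pow_mul]
  · have : (boundaryPoly H).coeff i = 0 := by
      ext k
      by_contra hne
      have h1 := h.quasiHomogeneous i k hne
      have h2 := Nat.find_min' hex h1.symm.le
      have h3 := Nat.mul_le_mul_left q h2
      omega
    rw [this]
    simpa using hlead.of_lt hlt

/-! ### The edge form near the root z. -/

section Root

variable {L : Type u} [Field L] {P : L[X]} [Fact (Irreducible P)] {q m s t : ℕ}

theorem sum_coeff_mul_root_pow :
    ∑ j ∈ Finset.range (P.natDegree + 1), AdjoinRoot.of P (P.coeff j) * AdjoinRoot.root P ^ j = 0 := by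
  rw [← AdjoinRoot.eval₂_root P, Polynomial.eval₂_eq_sum_range]

theorem leadHom_quasiHom (s t : ℕ) (z : AdjoinRoot P) :
    leadHom (AdjoinRoot.of P) s t z (quasiHom P q m) =
      ∑ j ∈ Finset.range (P.natDegree + 1),
        Polynomial.C (AdjoinRoot.of P (P.coeff j) * z ^ (t * (m * (P.natDegree - j)))) *
          (Polynomial.X + Polynomial.C (z ^ s)) ^ (q * j) := by
  rw [quasiHom, map_sum]
  exact Finset.sum_congr rfl fun j _ => leadHom_monomial _ _ _ _ _ _ _

theorem mul_eval₂_derivative {R S : Type*} [CommRing R] [CommRing S] (f : R →+* S) (z : S)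
    (p : R[X]) : z * (p.derivative).eval₂ f z =
      ∑ j ∈ Finset.range (p.natDegree + 1), f (p.coeff j) * j * z ^ j := by
  conv_lhs => rw [p.as_sum_range, Polynomial.derivative_sum, Polynomial.eval₂_finsetSum]
  rw [Finset.mul_sum]
  refine Finset.sum_congr rfl fun j _ => ?_
  rw [Polynomial.derivative_monomial, Polynomial.eval₂_monomial]
  rcases j with _ | j
  · simp
  · rw [Nat.add_sub_cancel, pow_succ, map_mul, map_natCast]; ring

/-- This Bézout computation turns the edge form at (z^t, z^s) into z^(tmℓ) P(z). -/
theorem exponent_eq (hst : q * s = m * t + 1) {j ℓ : ℕ} (hj : j ≤ ℓ) :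
    t * (m * (ℓ - j)) + s * (q * j) = t * m * ℓ + j := by
  obtain ⟨d, rfl⟩ := Nat.exists_eq_add_of_le hj
  rw [Nat.add_sub_cancel_left]
  linear_combination j * hst

theorem coeff_zero_leadHom_quasiHom (hst : q * s = m * t + 1) :
    (leadHom (AdjoinRoot.of P) s t (AdjoinRoot.root P) (quasiHom P q m)).coeff 0 = 0 := by
  rw [leadHom_quasiHom, Polynomial.finsetSum_coeff,
    ← mul_zero (AdjoinRoot.root P ^ (t * m * P.natDegree)), ← sum_coeff_mul_root_pow,
    Finset.mul_sum]
  refine Finset.sum_congr rfl fun j hj => ?_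
  rw [Polynomial.coeff_C_mul, Polynomial.coeff_X_add_C_pow, Nat.choose_zero_right, Nat.sub_zero,
    ← pow_mul, Nat.cast_one, mul_one, mul_assoc, ← pow_add,
    exponent_eq hst (Nat.lt_succ_iff.1 (Finset.mem_range.1 hj)), pow_add]
  ring

/-- Times z^s, this coefficient equals q z^(tmℓ) z P'(z), and P'(z) ≠ 0 because irreducible
polynomials over a perfect field are separable. -/
theorem coeff_one_leadHom_quasiHom [PerfectField L] (hP0 : P.coeff 0 ≠ 0) (hq : (q : L) ≠ 0)
    (hst : q * s = m * t + 1) :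
    (leadHom (AdjoinRoot.of P) s t (AdjoinRoot.root P) (quasiHom P q m)).coeff 1 ≠ 0 := by
  have hP : Irreducible P := Fact.out
  set z := AdjoinRoot.root P with hz
  have hz0 : z ≠ 0 := root_ne_zero hP hP0
  have hd : (P.derivative).eval₂ (AdjoinRoot.of P) z ≠ 0 :=
    (PerfectField.separable_of_irreducible hP).eval₂_derivative_ne_zero _ (AdjoinRoot.eval₂_root P)
  have hq' : (q : AdjoinRoot P) ≠ 0 := by
    rw [← map_natCast (AdjoinRoot.of P)]
    exact (map_ne_zero _).2 hq
  have key : (leadHom (AdjoinRoot.of P) s t z (quasiHom P q m)).coeff 1 * z ^ s =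
      q * z ^ (t * m * P.natDegree) * (z * (P.derivative).eval₂ (AdjoinRoot.of P) z) := by
    rw [mul_eval₂_derivative, leadHom_quasiHom, Polynomial.finsetSum_coeff, Finset.sum_mul,
      Finset.mul_sum]
    refine Finset.sum_congr rfl fun j hj => ?_
    rw [Polynomial.coeff_C_mul, Polynomial.coeff_X_add_C_pow, Nat.choose_one_right]
    rcases Nat.eq_zero_or_pos j with rfl | hj0
    · simp
    have hqj : 0 < q * j := Nat.mul_pos (Nat.pos_of_ne_zero fun h => by simp [h] at hst) hj0
    have h1 : (z ^ s) ^ (q * j - 1) * z ^ s = z ^ (s * (q * j)) := by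
      rw [← pow_succ, Nat.sub_add_cancel hqj, ← pow_mul]
    have h2 := congrArg (z ^ ·) (exponent_eq hst (Nat.lt_succ_iff.1 (Finset.mem_range.1 hj)))
    simp only [pow_add] at h2
    push_cast
    linear_combination (AdjoinRoot.of P (P.coeff j) * z ^ (t * (m * (P.natDegree - j))) * q * j) * h1
      + (AdjoinRoot.of P (P.coeff j) * q * j) * h2
  intro h0
  rw [h0, zero_mul] at key
  exact mul_ne_zero (mul_ne_zero hq' (pow_ne_zero _ hz0)) (mul_ne_zero hz0 hd) key.symm

theorem coeff_zero_sum_C_mul_pow {L' : Type u} [Field L'] (T : Finset ℕ) (a : ℕ → L') (z : L') :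
    (∑ b ∈ T, Polynomial.C (a b) * (Polynomial.X + Polynomial.C (z ^ s)) ^ b).coeff 0 =
      ∑ b ∈ T, a b * z ^ (s * b) := by
  rw [Polynomial.finsetSum_coeff]
  refine Finset.sum_congr rfl fun b _ => ?_
  rw [Polynomial.coeff_C_mul, Polynomial.coeff_X_add_C_pow]
  simp [pow_mul]

/-- At y = 0 the sum is Σ u_b z^(t v_b + s b), and q (t v_b + s b) = t W + b, so
`eq_zero_of_sum_root_pow` applies. -/
theorem eq_zero_of_coeff_zero_eq_zero (hP0 : P.coeff 0 ≠ 0) (hq : 0 < q)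
    (hst : q * s = m * t + 1) {W : ℕ} (v : ℕ → ℕ) (u : ℕ → L)
    (hw : ∀ b < q * P.natDegree, u b ≠ 0 → q * v b + m * b = W)
    (h : (∑ b ∈ Finset.range (q * P.natDegree),
      Polynomial.C (AdjoinRoot.of P (u b) * AdjoinRoot.root P ^ (t * v b)) *
        (Polynomial.X + Polynomial.C (AdjoinRoot.root P ^ s)) ^ b).coeff 0 = 0) :
    ∀ b < q * P.natDegree, u b = 0 := by
  classical
  rw [coeff_zero_sum_C_mul_pow] at h
  have key := eq_zero_of_sum_root_pow hP0 (w := t * W) hq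
    ((Finset.range (q * P.natDegree)).filter fun b => u b ≠ 0) (fun b => t * v b + s * b) ?_ ?_ u ?_
  · intro b hb
    by_contra hne
    exact hne (key b (Finset.mem_filter.2 ⟨Finset.mem_range.2 hb, hne⟩))
  · intro b hb
    obtain ⟨hb, hne⟩ := Finset.mem_filter.1 hb
    rw [← hw b (Finset.mem_range.1 hb) hne]
    linear_combination b * hst
  · intro b hb
    exact Finset.mem_range.1 (Finset.mem_filter.1 hb).1
  · rw [← h, Finset.sum_filter]
    refine Finset.sum_congr rfl fun b _ => ?_
    split_ifs with hne
    · rw [pow_add]; ring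
    · rw [not_not.1 hne]; simp

theorem coeff_quasiHom (P : L[X]) (hq : 0 < q) (m b : ℕ) : (quasiHom P q m).coeff b =
    Polynomial.monomial (m * (P.natDegree - b / q)) (if q ∣ b then P.coeff (b / q) else 0) := by
  rw [quasiHom, Polynomial.finsetSum_coeff]
  simp only [Polynomial.coeff_monomial]
  split_ifs with h
  · obtain ⟨j, rfl⟩ := h
    rw [Nat.mul_div_cancel_left _ hq]
    by_cases hj : j ≤ P.natDegree
    · rw [Finset.sum_eq_single j, if_pos rfl]
      · intro k _ hk
        rw [if_neg fun h => hk (Nat.eq_of_mul_eq_mul_left hq h)]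
      · intro h
        exact absurd (Finset.mem_range.2 (Nat.lt_succ_iff.2 hj)) h
    · rw [Polynomial.coeff_eq_zero_of_natDegree_lt (by omega), map_zero]
      refine Finset.sum_eq_zero fun k hk => ?_
      rw [if_neg]
      intro h
      have := Nat.eq_of_mul_eq_mul_left hq h
      have := Finset.mem_range.1 hk
      omega
  · rw [map_zero]
    refine Finset.sum_eq_zero fun k _ => if_neg ?_
    rintro rfl
    exact h ⟨k, rfl⟩

/-- Subtract the right side: both have weight W and vanish at y = 0, and the terms b = qℓ cancel
because P is monic. The difference has only b < qℓ, so it is zero by independence. -/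
theorem sum_eq_leadHom_quasiHom (hPm : P.Monic) (hP0 : P.coeff 0 ≠ 0) (hq : 0 < q)
    (hst : q * s = m * t + 1) {W : ℕ} (v : ℕ → ℕ) (u : ℕ → L)
    (hw : ∀ b < q * P.natDegree + 1, u b ≠ 0 → q * v b + m * b = W)
    (hu : u (q * P.natDegree) ≠ 0)
    (h : (∑ b ∈ Finset.range (q * P.natDegree + 1),
      Polynomial.C (AdjoinRoot.of P (u b) * AdjoinRoot.root P ^ (t * v b)) *
        (Polynomial.X + Polynomial.C (AdjoinRoot.root P ^ s)) ^ b).coeff 0 = 0) :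
    (∑ b ∈ Finset.range (q * P.natDegree + 1),
      Polynomial.C (AdjoinRoot.of P (u b) * AdjoinRoot.root P ^ (t * v b)) *
        (Polynomial.X + Polynomial.C (AdjoinRoot.root P ^ s)) ^ b) =
    Polynomial.C (AdjoinRoot.of P (u (q * P.natDegree)) *
      AdjoinRoot.root P ^ (t * v (q * P.natDegree))) *
        leadHom (AdjoinRoot.of P) s t (AdjoinRoot.root P) (quasiHom P q m) := by
  classical
  set z := AdjoinRoot.root P with hz
  set κ := u (q * P.natDegree) with hκ
  set V := v (q * P.natDegree) with hV
  set a : ℕ → L := fun b => if q ∣ b then P.coeff (b / q) else 0 with ha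
  -- Where u b = 0 the hypotheses say nothing about v b. If q divides b, the weight W dictates the
  -- value used instead.
  set v' : ℕ → ℕ := fun b => if u b ≠ 0 then v b else V + m * (P.natDegree - b / q) with hv'
  set D : ℕ → L := fun b => u b - κ * a b with hD
  have hW : q * V + m * (q * P.natDegree) = W := hw _ (Nat.lt_succ_self _) hu
  have hwt : ∀ b < q * P.natDegree + 1, q ∣ b →
      q * (V + m * (P.natDegree - b / q)) + m * b = W := by
    rintro _ hb ⟨j, rfl⟩
    have hj : j ≤ P.natDegree := Nat.le_of_mul_le_mul_left (Nat.lt_succ_iff.1 hb) hq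
    obtain ⟨d, hd⟩ := Nat.exists_eq_add_of_le hj
    rw [Nat.mul_div_cancel_left _ hq, ← hW, hd, Nat.add_sub_cancel_left]
    ring
  have hwv' : ∀ b < q * P.natDegree + 1, (u b ≠ 0 ∨ q ∣ b) → q * v' b + m * b = W := by
    intro b hb hor
    simp only [hv']
    split_ifs with h1
    · exact hw b hb h1
    · exact hwt b hb (hor.resolve_left h1)
  have hDsum : (∑ b ∈ Finset.range (q * P.natDegree + 1),
      Polynomial.C (AdjoinRoot.of P (u b) * z ^ (t * v b)) *
        (Polynomial.X + Polynomial.C (z ^ s)) ^ b) -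
      Polynomial.C (AdjoinRoot.of P κ * z ^ (t * V)) *
        leadHom (AdjoinRoot.of P) s t z (quasiHom P q m) =
      ∑ b ∈ Finset.range (q * P.natDegree),
        Polynomial.C (AdjoinRoot.of P (D b) * z ^ (t * v' b)) *
          (Polynomial.X + Polynomial.C (z ^ s)) ^ b := by
    have hlast : D (q * P.natDegree) = 0 := by
      simp only [hD, ha]
      rw [if_pos (dvd_mul_right _ _), Nat.mul_div_cancel_left _ hq, hPm.coeff_natDegree, mul_one,
        sub_self]
    have hext : ∑ b ∈ Finset.range (q * P.natDegree),
        Polynomial.C (AdjoinRoot.of P (D b) * z ^ (t * v' b)) *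
          (Polynomial.X + Polynomial.C (z ^ s)) ^ b =
        ∑ b ∈ Finset.range (q * P.natDegree + 1),
        Polynomial.C (AdjoinRoot.of P (D b) * z ^ (t * v' b)) *
          (Polynomial.X + Polynomial.C (z ^ s)) ^ b := by
      rw [Finset.sum_range_succ, hlast]; simp
    rw [hext, leadHom_eq_sum _ _ _ _ _ (n := q * P.natDegree + 1)
      (by rw [(quasiHom_monic hPm hq m).2]; omega), Finset.mul_sum, ← Finset.sum_sub_distrib]
    refine Finset.sum_congr rfl fun b hb => ?_
    rw [coeff_quasiHom P hq, Polynomial.eval₂_monomial, ← mul_assoc, ← Polynomial.C_mul, ← sub_mul,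
      ← Polynomial.C_sub]
    congr 2
    have h1 : AdjoinRoot.of P (u b) * z ^ (t * v b) = AdjoinRoot.of P (u b) * z ^ (t * v' b) := by
      by_cases hub : u b = 0
      · simp [hub]
      · simp only [hv', if_pos hub]
    have h2 : AdjoinRoot.of P (a b) * z ^ (t * (V + m * (P.natDegree - b / q))) =
        AdjoinRoot.of P (a b) * z ^ (t * v' b) := by
      by_cases hdvd : q ∣ b
      · have e1 := hwt b (Finset.mem_range.1 hb) hdvd
        have e2 := hwv' b (Finset.mem_range.1 hb) (Or.inr hdvd)
        rw [Nat.eq_of_mul_eq_mul_left hq (Nat.add_right_cancel (e1.trans e2.symm))]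
      · simp [ha, hdvd]
    rw [h1, hD, map_sub, map_mul, sub_mul, mul_assoc (AdjoinRoot.of P κ) (AdjoinRoot.of P (a b)),
      ← h2, mul_add, pow_add, pow_mul z t (m * _)]
    ring
  rw [← sub_eq_zero, hDsum]
  have hD0 := eq_zero_of_coeff_zero_eq_zero hP0 hq hst (W := W) v' D ?_ ?_
  · refine Finset.sum_eq_zero fun b hb => ?_
    rw [hD0 b (Finset.mem_range.1 hb)]; simp
  · intro b hb hne
    refine hwv' b (by omega) ?_
    by_contra! hcon
    exact hne (by simp [hD, ha, hcon.1, hcon.2])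
  · rw [← hDsum, Polynomial.coeff_sub, h, Polynomial.coeff_C_mul, hz,
      coeff_zero_leadHom_quasiHom hst, mul_zero, sub_zero]

/-- Leading parts of a sum of terms of the form `x ^ v y ^ b` after a Puiseux transformation. -/
theorem exists_hasLead_sum (n : ℕ) (g : ℕ → (AdjoinRoot P)⟦X⟧[X]) (v : ℕ → ℕ) (u : ℕ → L)
    (p : ℕ → (AdjoinRoot P)[X])
    (hg : ∀ b < n, u b = 0 → g b = 0)
    (hl : ∀ b < n, u b ≠ 0 → HasLead (g b) (q * v b + m * b)
      (Polynomial.C (AdjoinRoot.of P (u b) * AdjoinRoot.root P ^ (t * v b)) * p b))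
    (hne : ∃ b < n, u b ≠ 0) :
    ∃ (W : ℕ) (u' : ℕ → L), (∀ b, u' b = u b ∨ u' b = 0) ∧
      (∀ b < n, u' b ≠ 0 → q * v b + m * b = W) ∧ (∃ b < n, u' b ≠ 0) ∧
      HasLead (∑ b ∈ Finset.range n, g b) W (∑ b ∈ Finset.range n,
        Polynomial.C (AdjoinRoot.of P (u' b) * AdjoinRoot.root P ^ (t * v b)) * p b) := by
  classical
  have hex : ∃ W, ∃ b < n, u b ≠ 0 ∧ q * v b + m * b = W := by
    obtain ⟨b, hb, hub⟩ := hne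
    exact ⟨_, b, hb, hub, rfl⟩
  obtain ⟨b₀, hb₀, hu₀, hW⟩ := Nat.find_spec hex
  -- W is the least weight occurring; u' keeps only the terms of that weight.
  refine ⟨Nat.find hex, fun b => if q * v b + m * b = Nat.find hex then u b else 0, fun b => ?_,
    fun b _ h => ?_, ⟨b₀, hb₀, by simpa only [if_pos hW] using hu₀⟩, ?_⟩
  · dsimp only; split_ifs <;> simp
  · by_contra hne; simp [hne] at h
  · refine HasLead.sum _ _ _ _ fun b hb => ?_
    have hb' := Finset.mem_range.1 hb
    by_cases hub : u b = 0
    · rw [hg b hb' hub]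
      simpa [hub] using HasLead.zero _
    · have hlb := hl b hb' hub
      beta_reduce
      rcases (Nat.find_min' hex ⟨b, hb', hub, rfl⟩).eq_or_lt with heq | hlt
      · rw [if_pos heq.symm]; rwa [← heq] at hlb
      · rw [if_neg hlt.ne']
        simpa using hlb.of_lt hlt

end Root

/-! ### Passing from φ_k to φ_{k+1}. -/

section Transfer

variable {K L : Type u} [Field K] [Field L] {P : L[X]} [Fact (Irreducible P)] {q m s t : ℕ}
  {π : K⟦X⟧[X] →+* L⟦X⟧[X]} {π' : K⟦X⟧[X] →+* (AdjoinRoot P)⟦X⟧[X]} {c : Prop}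
  {φ : K⟦X⟧[X]} {V : ℕ} {κ : L}

/-- Each nonzero digit other than 1 pulls back without a factor y and φ^b brings exactly y^b, so
every term of the expansion is monomial to leading order. The digit 1 is tracked separately because
the exact data of φ^b are needed later. -/
theorem exists_lead_adic_terms
    (hσ : ∀ A v b u, MonoLead c v b u (π A) → HasLead (π' A) (q * v + m * b)
      (Polynomial.C (AdjoinRoot.of P u * AdjoinRoot.root P ^ (t * v)) *
        (Polynomial.X + Polynomial.C (AdjoinRoot.root P ^ s)) ^ b))
    (hπφ : MonoLead c V 1 κ (π φ)) (hκ : κ ≠ 0)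
    (hsmall : ∀ A : K⟦X⟧[X], A ≠ 0 → A.degree < φ.natDegree →
      ∃ v u, u ≠ 0 ∧ MonoLead c v 0 u (π A))
    (a : ℕ → K⟦X⟧[X]) (ha : ∀ b, (a b).degree < φ.natDegree ∨ a b = 1) :
    ∃ (v : ℕ → ℕ) (u : ℕ → L), (∀ b, u b = 0 → a b = 0) ∧
      (∀ b, u b ≠ 0 → HasLead (π' (a b * φ ^ b)) (q * v b + m * b)
        (Polynomial.C (AdjoinRoot.of P (u b) * AdjoinRoot.root P ^ (t * v b)) *
          (Polynomial.X + Polynomial.C (AdjoinRoot.root P ^ s)) ^ b)) ∧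
      (∀ b, a b = 1 → u b = κ ^ b ∧ v b = b * V) := by
  have key : ∀ b, ∃ (v : ℕ) (u : L), (u = 0 → a b = 0) ∧
      (u ≠ 0 → HasLead (π' (a b * φ ^ b)) (q * v + m * b)
        (Polynomial.C (AdjoinRoot.of P u * AdjoinRoot.root P ^ (t * v)) *
          (Polynomial.X + Polynomial.C (AdjoinRoot.root P ^ s)) ^ b)) ∧
      (a b = 1 → u = κ ^ b ∧ v = b * V) := by
    intro b
    have hpow := hπφ.pow b
    rw [mul_one] at hpow
    by_cases h1 : a b = 1
    · refine ⟨b * V, κ ^ b, fun h => absurd h (pow_ne_zero _ hκ), fun _ => ?_, fun _ => ⟨rfl, rfl⟩⟩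
      rw [h1, one_mul]
      exact hσ _ _ _ _ (by rw [map_pow]; exact hpow)
    · by_cases h0 : a b = 0
      · exact ⟨0, 0, fun _ => h0, fun h => absurd rfl h, fun h => absurd h h1⟩
      · obtain ⟨v, u, hu, hmono⟩ := hsmall (a b) h0 ((ha b).resolve_right h1)
        refine ⟨v + b * V, u * κ ^ b, fun h => absurd h (mul_ne_zero hu (pow_ne_zero _ hκ)),
          fun _ => hσ _ _ _ _ ?_, fun h => absurd h h1⟩
        rw [map_mul, map_pow]
        simpa using hmono.mul hpow
  choose v u h1 h2 h3 using key
  exact ⟨v, u, h1, h2, h3⟩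

theorem exists_monoLead_next (hφ : φ.Monic) (hP0 : P.coeff 0 ≠ 0) (hq : 0 < q)
    (hst : q * s = m * t + 1)
    (hσ : ∀ A v b u, MonoLead c v b u (π A) → HasLead (π' A) (q * v + m * b)
      (Polynomial.C (AdjoinRoot.of P u * AdjoinRoot.root P ^ (t * v)) *
        (Polynomial.X + Polynomial.C (AdjoinRoot.root P ^ s)) ^ b))
    (hπφ : MonoLead c V 1 κ (π φ)) (hκ : κ ≠ 0)
    (hsmall : ∀ A : K⟦X⟧[X], A ≠ 0 → A.degree < φ.natDegree →
      ∃ v u, u ≠ 0 ∧ MonoLead c v 0 u (π A))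
    {A : K⟦X⟧[X]} (hA : A ≠ 0)
    (hdeg : A.degree < ((q * P.natDegree * φ.natDegree : ℕ) : WithBot ℕ)) :
    ∃ v u, u ≠ 0 ∧ MonoLead False v 0 u (π' A) := by
  obtain ⟨a, ha, rfl⟩ := exists_adic_expansion hφ _ A hdeg
  obtain ⟨v, u, h0, hl, -⟩ := exists_lead_adic_terms hσ hπφ hκ hsmall a fun b => Or.inl (ha b)
  have hne : ∃ b < q * P.natDegree, u b ≠ 0 := by
    by_contra! hcon
    refine hA (Finset.sum_eq_zero fun b hb => ?_)
    rw [h0 b (hcon b (Finset.mem_range.1 hb)), zero_mul]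
  obtain ⟨W, u', -, hW, ⟨b, hb, hub⟩, hlead⟩ := exists_hasLead_sum (q * P.natDegree)
    (fun b => π' (a b * φ ^ b)) v u _ (fun b _ h => by simp [h0 b h]) (fun b _ => hl b) hne
  rw [← map_sum] at hlead
  refine ⟨W, _, fun hcon => ?_, hlead.monoLead_zero⟩
  exact hub (eq_zero_of_coeff_zero_eq_zero hP0 hq hst v u' hW hcon b hb)

/-- Write φ' = φ^n + lower terms, n = qℓ. Its leading form vanishes at y = 0, hence is a multiple of
the edge form, whose coefficient of y is the last factor of the result. -/
theorem monoLead_next_of_eval_eq_zero (hφ : φ.Monic) (hPm : P.Monic) (hP0 : P.coeff 0 ≠ 0)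
    (hq : 0 < q) (hst : q * s = m * t + 1)
    (hσ : ∀ A v b u, MonoLead c v b u (π A) → HasLead (π' A) (q * v + m * b)
      (Polynomial.C (AdjoinRoot.of P u * AdjoinRoot.root P ^ (t * v)) *
        (Polynomial.X + Polynomial.C (AdjoinRoot.root P ^ s)) ^ b))
    (hπφ : MonoLead c V 1 κ (π φ)) (hκ : κ ≠ 0)
    (hsmall : ∀ A : K⟦X⟧[X], A ≠ 0 → A.degree < φ.natDegree →
      ∃ v u, u ≠ 0 ∧ MonoLead c v 0 u (π A))
    {φ' : K⟦X⟧[X]} (hφ' : φ'.Monic) (hdeg : φ'.natDegree = q * P.natDegree * φ.natDegree)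
    (heval : (π' φ').eval 0 = 0) :
    MonoLead False (q * (q * P.natDegree * V) + m * (q * P.natDegree)) 1
      (AdjoinRoot.of P (κ ^ (q * P.natDegree)) *
        AdjoinRoot.root P ^ (t * (q * P.natDegree * V)) *
          (leadHom (AdjoinRoot.of P) s t (AdjoinRoot.root P) (quasiHom P q m)).coeff 1)
      (π' φ') := by
  classical
  set n := q * P.natDegree with hn
  have hlt : (φ' - φ ^ n).degree < ((n * φ.natDegree : ℕ) : WithBot ℕ) := by
    rw [← hdeg, ← Polynomial.degree_eq_natDegree hφ'.ne_zero]
    refine Polynomial.degree_sub_lt_left ?_ hφ'.ne_zero ?_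
    · rw [Polynomial.degree_eq_natDegree hφ'.ne_zero,
        Polynomial.degree_eq_natDegree (hφ.pow n).ne_zero, hdeg, hφ.natDegree_pow]
    · rw [hφ'.leadingCoeff, (hφ.pow n).leadingCoeff]
  obtain ⟨a, ha, hsum⟩ := exists_adic_expansion hφ n _ hlt
  set a' : ℕ → K⟦X⟧[X] := fun b => if b = n then 1 else a b with ha'
  have hφ'sum : φ' = ∑ b ∈ Finset.range (n + 1), a' b * φ ^ b := by
    rw [Finset.sum_range_succ, ha']
    beta_reduce
    rw [if_pos rfl, one_mul, ← sub_eq_iff_eq_add, hsum]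
    refine Finset.sum_congr rfl fun b hb => ?_
    rw [if_neg (Finset.mem_range.1 hb).ne]
  obtain ⟨v, u, h0, hl, h1⟩ := exists_lead_adic_terms hσ hπφ hκ hsmall a' fun b => by
    by_cases hb : b = n
    · right; simp [ha', hb]
    · left; simpa [ha', hb] using ha b
  obtain ⟨hun, hvn⟩ := h1 n (by simp [ha'])
  have hun0 : u n ≠ 0 := by rw [hun]; exact pow_ne_zero _ hκ
  obtain ⟨W, u', hu', hW, ⟨b, hb, hub⟩, hlead⟩ := exists_hasLead_sum (n + 1)
    (fun b => π' (a' b * φ ^ b)) v u _ (fun b _ h => by simp [h0 b h]) (fun b _ => hl b)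
    ⟨n, Nat.lt_succ_self n, hun0⟩
  rw [← map_sum, ← hφ'sum] at hlead
  have hc0 := hlead.coeff_zero heval
  -- If φ^n were not of least weight, the least-weight terms would all have b < n, and by
  -- independence they could not sum to zero at y = 0.
  have hu'n : u' n ≠ 0 := by
    intro hcon
    rw [Finset.sum_range_succ, hcon] at hc0
    simp only [map_zero, zero_mul, add_zero] at hc0
    have hz := eq_zero_of_coeff_zero_eq_zero hP0 hq hst v u' (fun b hb => hW b (by omega)) hc0
    rcases (Nat.lt_succ_iff.1 hb).eq_or_lt with rfl | hlt
    · exact hub hcon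
    · exact hub (hz b hlt)
  have hWn := hW n (Nat.lt_succ_self n) hu'n
  rw [sum_eq_leadHom_quasiHom hPm hP0 hq hst v u' hW hu'n hc0, ← hn, (hu' n).resolve_right hu'n,
    ← hWn, hun, hvn] at hlead
  have := hlead.monoLead_one heval
  rwa [Polynomial.coeff_C_mul] at this

end Transfer

/-! ### The invariants and their propagation. -/

/-- The invariants of the run after `k` iterations: `v` and `u` are the values and the leading
coefficients of `φ_{-1}, …, φ_k`. -/
structure Invariant {K : Type u} [Field K] (F : K⟦X⟧[X]) (k : ℕ) (S : Stage K)
    (φ : ℕ → K⟦X⟧[X]) (r v : ℕ → ℕ) (u : ℕ → S.L) : Prop where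
  perfect : PerfectField S.L
  mono : ∀ i ≤ k, MonoLead (k = 0) (v i) 0 (u i) (S.pi (Phi φ i))
  mono_last : MonoLead (k = 0) (v (k + 1)) 1 (u (k + 1)) (S.pi (φ k))
  ne_zero : ∀ i ≤ k + 1, u i ≠ 0
  v_zero : 0 < v 0
  pi_C : ∀ a, S.pi (Polynomial.C (PowerSeries.C a)) = Polynomial.C (PowerSeries.C (S.ι a))
  small : ∀ A : K⟦X⟧[X], A ≠ 0 → A.degree < (φ k).natDegree →
    ∃ v' u', u' ≠ 0 ∧ MonoLead (k = 0) v' 0 u' (S.pi A)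
  factor : ∃ U, S.pi F = Polynomial.C (PowerSeries.X ^ (S.N * v (k + 1))) * S.H * U ∧
    MonoLead (k = 0) 0 0 (u (k + 1) ^ S.N) U
  monic : S.H.Monic
  natDegree_eq : S.H.natDegree = S.N
  map_eq : k ≠ 0 → S.H.map PowerSeries.constantCoeff = Polynomial.X ^ S.N
  N_ne_zero : (S.N : K) ≠ 0
  indep : Indep S.ι r (k + 1) v u

theorem exists_monoLead_C {L : Type u} [Field L] {a : L⟦X⟧} (ha : a ≠ 0) :
    ∃ v u, u ≠ 0 ∧ MonoLead True v 0 u (Polynomial.C a) := by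
  obtain ⟨n, hn⟩ := ENat.ne_top_iff_exists.1 (fun h => ha (PowerSeries.order_eq_top.1 h))
  refine ⟨n, _, coeff_order_ne_zero hn.symm, ?_⟩
  simpa using exists_monoLead_C_mul_X_pow (a := a) (n := n)
    (fun j hj => PowerSeries.coeff_of_lt_order j (by rw [← hn]; exact_mod_cast hj)) 0

theorem tauHom_eq_X {L : Type u} [Field L] {c : L⟦X⟧} {φ : L⟦X⟧[X]} (hφ : φ.Monic)
    (hdeg : φ.natDegree = 1) (h : (tauHom c φ).eval 0 = 0) : tauHom c φ = Polynomial.X := by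
  have hm : (tauHom c φ).Monic := by rw [tauHom_eq_taylor]; exact hφ.comp_X_add_C _
  have hd : (tauHom c φ).natDegree = 1 := by rw [tauHom_eq_taylor, Polynomial.natDegree_taylor, hdeg]
  rw [hm.eq_X_add_C hd, Polynomial.coeff_zero_eq_eval_zero, h]
  simp

/-- Here φ_0 is monic of degree one, so its pull-back is y itself: the values of (x, φ_0) are (1, 0)
and all leading coefficients are 1. -/
theorem invariant_init {K : Type u} [Field K] [PerfectField K] {F : K⟦X⟧[X]} (hF : F.Monic)
    (hd : (F.natDegree : K) ≠ 0) {φ : ℕ → K⟦X⟧[X]} (hφ : IsMinimalPoly (Stage.init F) (φ 0))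
    (r : ℕ → ℕ) : Invariant F 0 (Stage.init F) φ r (fun i => if i = 0 then 1 else 0)
      (fun _ => (1 : K)) := by
  have hdeg : (φ 0).natDegree = 1 := hφ.natDegree_eq
  have hX : tauHom (shift F) (φ 0) = Polynomial.X := tauHom_eq_X hφ.monic hdeg hφ.eval_eq_zero
  have hfac : tauHom (shift F) F =
      Polynomial.C (PowerSeries.X ^ (F.natDegree * 0)) * tauHom (shift F) F * 1 := by simp
  refine
    { perfect := ‹PerfectField K›
      mono := ?_
      mono_last := ?_
      ne_zero := fun _ _ => one_ne_zero (α := K)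
      v_zero := one_pos
      pi_C := fun a => tauHom_C _ _
      small := ?_
      factor := ?_
      monic := ?_
      natDegree_eq := ?_
      map_eq := fun h => absurd rfl h
      N_ne_zero := hd
      indep := Indep.of_one _ _ one_ne_zero (one_ne_zero (α := K)) }
  · intro i hi
    obtain rfl : i = 0 := by omega
    change MonoLead _ 1 0 (1 : K) (tauHom (shift F) (Polynomial.C PowerSeries.X))
    rw [tauHom_C]
    exact ⟨1, by simp, by simp, fun _ => ⟨1, by simp⟩⟩
  · change MonoLead _ 0 1 (1 : K) (tauHom (shift F) (φ 0))
    rw [hX]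
    exact ⟨1, by simp, by simp, fun _ => ⟨1, by simp⟩⟩
  · intro A hA hAd
    have h0 : A.natDegree < 1 := (Polynomial.natDegree_lt_iff_degree_lt hA).2 (by rwa [hdeg] at hAd)
    obtain ⟨a, rfl⟩ : ∃ a, A = Polynomial.C a :=
      ⟨_, Polynomial.eq_C_of_natDegree_le_zero (Nat.lt_one_iff.1 h0).le⟩
    obtain ⟨v, u, hu, h⟩ := exists_monoLead_C (a := a) (fun h => hA (by rw [h, Polynomial.C_0]))
    refine ⟨v, u, hu, ?_⟩
    change MonoLead _ v 0 u (tauHom (shift F) (Polynomial.C a))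
    rw [tauHom_C]
    obtain ⟨U, h1, h2, h3⟩ := h
    exact ⟨U, h1, h2, fun _ => h3 trivial⟩
  · refine ⟨1, ?_, 1, by simp, ?_, fun _ => ⟨1, by simp⟩⟩
    · exact hfac
    · change PowerSeries.constantCoeff ((1 : K⟦X⟧[X]).coeff 0) = (1 : K) ^ F.natDegree
      simp
  · change (tauHom (shift F) F).Monic
    rw [tauHom_eq_taylor]; exact hF.comp_X_add_C _
  · change (tauHom (shift F) F).natDegree = F.natDegree
    rw [tauHom_eq_taylor, Polynomial.natDegree_taylor]

theorem sigmaHom_C_C {L L' : Type u} [Field L] [Field L'] (j : L →+* L') (q : ℕ) (hq : q ≠ 0)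
    (m s t : ℕ) (z : L') (a : L) :
    sigmaHom j q hq m s t z (Polynomial.C (PowerSeries.C a)) =
      Polynomial.C (PowerSeries.C (j a)) := by
  have : PowerSeries.rescale (z ^ t) (PowerSeries.C (j a)) = PowerSeries.C (j a) := by
    ext n
    rw [PowerSeries.coeff_rescale, PowerSeries.coeff_C]
    split_ifs with h
    · rw [h, pow_zero, one_mul]
    · rw [mul_zero]
  rw [sigmaHom_C, PowerSeries.map_C, this, PowerSeries.expand_C]

/-- So the Abhyankar shift of a Weierstrass polynomial does not alter leading forms. -/
theorem constantCoeff_shift {L : Type u} [Field L] {G : L⟦X⟧[X]}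
    (hG : G.map PowerSeries.constantCoeff = Polynomial.X ^ G.natDegree) :
    PowerSeries.constantCoeff (shift G) = 0 := by
  rcases Nat.eq_zero_or_pos G.natDegree with h | h
  · simp [shift, h]
  · have : PowerSeries.constantCoeff (G.coeff (G.natDegree - 1)) = 0 := by
      rw [← Polynomial.coeff_map, hG, Polynomial.coeff_X_pow, if_neg (by omega)]
    simp [shift, this]

theorem eq_of_X_pow_mul_eq {L : Type u} [Field L] {n N : ℕ} {A B : L[X]} (hA : A.coeff 0 ≠ 0)
    (hB : B.coeff 0 ≠ 0) (h : Polynomial.X ^ n * A = Polynomial.X ^ N * B) :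
    n = N ∧ A.coeff 0 = B.coeff 0 := by
  have key : ∀ {n N : ℕ} {A B : L[X]}, A.coeff 0 ≠ 0 →
      Polynomial.X ^ n * A = Polynomial.X ^ N * B → N ≤ n := by
    intro n N A B hA h
    by_contra! hlt
    have h1 := congrArg (fun p => p.coeff n) h
    simp only [Polynomial.coeff_X_pow_mul'] at h1
    rw [if_pos le_rfl, if_neg (by omega), Nat.sub_self] at h1
    exact hA h1
  have hnN := le_antisymm (key hB h.symm) (key hA h)
  refine ⟨hnN, ?_⟩
  rw [hnN] at h
  rw [mul_left_cancel₀ (pow_ne_zero N Polynomial.X_ne_zero) h]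

theorem invariant_next {K : Type u} [Field K] {F : K⟦X⟧[X]} {k : ℕ} {S T : Stage K}
    {φ : ℕ → K⟦X⟧[X]} {r v : ℕ → ℕ} {u : ℕ → S.L} (hI : Invariant F k S φ r v u) (hST : Step S T)
    (hφ : IsMinimalPoly S (φ k)) (hφ' : IsMinimalPoly T (φ (k + 1)))
    (hr : r (k + 1) = T.q * T.ell) :
    ∃ (v' : ℕ → ℕ) (u' : ℕ → T.L), Invariant F (k + 1) T φ r v' u' := by
  classical
  obtain ⟨q, hq, m, s, t, N, P, hP, F', G, U, hE, htq, hst, hF', hW, rfl⟩ := hST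
  have hq0 : 0 < q := Nat.pos_of_ne_zero hq
  have := hI.perfect
  set z := AdjoinRoot.root P with hz
  have hz0 : z ≠ 0 := root_ne_zero Fact.out hE.coeff_zero
  obtain ⟨Q, hFQ, hQ0, hGm, hGmap⟩ := exists_polynomial_cofactor hW
  obtain ⟨hdegN, hbd⟩ := hE.natDegree_eq hI.monic
  rw [hI.natDegree_eq] at hdegN
  -- N and q divide the previous N_k, which is nonzero in K.
  have hNK : (N : K) ≠ 0 := fun h => hI.N_ne_zero (by rw [hdegN]; push_cast; rw [h, mul_zero])
  have hqK : (q : S.L) ≠ 0 := by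
    rw [← map_natCast S.ι]
    exact (map_ne_zero _).2 fun h => hI.N_ne_zero (by rw [hdegN]; push_cast; rw [h]; ring)
  set Ps := leadHom (AdjoinRoot.of P) s t z (quasiHom P q m) with hPs
  have hPs0 : Ps.coeff 0 = 0 := coeff_zero_leadHom_quasiHom hst
  have hPs1 : Ps.coeff 1 ≠ 0 := coeff_one_leadHom_quasiHom hE.coeff_zero hqK hst
  have hcm : 0 < m ∨ k = 0 := by
    rcases Nat.eq_zero_or_pos k with h | h
    · exact Or.inr h
    · left
      refine hE.m_pos hI.monic ?_ (by rw [hI.natDegree_eq]; exact hI.map_eq h.ne')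
      rw [hI.natDegree_eq]
      exact Nat.pos_of_ne_zero fun h => hI.N_ne_zero (by rw [h, Nat.cast_zero])
  -- the Weierstrass polynomial has degree `N`
  have hF'map : F'.map PowerSeries.constantCoeff = Ps ^ N := by
    have h1 : HasLead (sigmaHom (AdjoinRoot.of P) q hq m s t z S.H) (q * m * P.natDegree * N)
      (F'.map PowerSeries.constantCoeff) := ⟨F', hF', rfl⟩
    rw [h1.unique (hE.hasLead_sigmaHom hI.monic _ hq s t z), map_pow]
  obtain ⟨hGN, hQN⟩ : G.natDegree = N ∧ PowerSeries.constantCoeff (Q.coeff 0) = Ps.coeff 1 ^ N := by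
    -- Write the edge form as y p with p(0) ≠ 0. At x = 0, F' = G Q reads y^N p^N = y^(deg G) Q;
    -- compare orders in y and lowest coefficients.
    obtain ⟨p, hp⟩ := Polynomial.X_dvd_iff.2 hPs0
    have h1 : p.coeff 0 = Ps.coeff 1 := by rw [hp, Polynomial.coeff_X_mul]
    have h2 := eq_of_X_pow_mul_eq (n := G.natDegree) (N := N)
      (A := Q.map PowerSeries.constantCoeff) (B := p ^ N) (by simpa using hQ0)
      (by rw [Polynomial.coeff_zero_eq_eval_zero, Polynomial.eval_pow,
            ← Polynomial.coeff_zero_eq_eval_zero, h1]; exact pow_ne_zero _ hPs1)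
      (by rw [← hGmap, ← Polynomial.map_mul, ← hFQ, hF'map, hp, mul_pow])
    refine ⟨h2.1, ?_⟩
    rw [← Polynomial.coeff_map, h2.2, Polynomial.coeff_zero_eq_eval_zero, Polynomial.eval_pow,
      ← Polynomial.coeff_zero_eq_eval_zero, h1]
  have hc0 : PowerSeries.constantCoeff (shift G) = 0 := constantCoeff_shift hGmap
  set π' : K⟦X⟧[X] →+* (AdjoinRoot P)⟦X⟧[X] := (tauHom (shift G)).comp
    ((sigmaHom (AdjoinRoot.of P) q hq m s t z).comp S.pi) with hπ'
  have hσ : ∀ A v b u, MonoLead (k = 0) v b u (S.pi A) → HasLead (π' A) (q * v + m * b)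
        (Polynomial.C (AdjoinRoot.of P u * z ^ (t * v)) *
          (Polynomial.X + Polynomial.C (z ^ s)) ^ b) := fun A v b u h =>
    (h.sigmaHom (AdjoinRoot.of P) q hq m s t z hcm).tauHom hc0
  have hdφ : (φ (k + 1)).natDegree = q * P.natDegree * (φ k).natDegree := by
    rw [hφ'.natDegree_eq, hφ.natDegree_eq]
    change S.e * q * (S.f * P.natDegree) = _
    ring
  have hlast := monoLead_next_of_eval_eq_zero hφ.monic hE.monic hE.coeff_zero hq0 hst hσ
    hI.mono_last (hI.ne_zero _ le_rfl) hI.small hφ'.monic hdφ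
    (show (π' _).eval 0 = 0 from hφ'.eval_eq_zero)
  set n := q * P.natDegree with hn
  -- Position i carries φ_{i-1}: the older elements pull back without y, φ_k carries one factor y
  -- and so gains m and z^s, and φ_{k+1} is given by `hlast`.
  let v' : ℕ → ℕ := fun i => if i ≤ k then q * v i else if i = k + 1 then q * v i + m else
    q * (n * v (k + 1)) + m * n
  let u' : ℕ → AdjoinRoot P := fun i => if i ≤ k then AdjoinRoot.of P (u i) * z ^ (t * v i) else
    if i = k + 1 then AdjoinRoot.of P (u i) * z ^ (t * v i + s) else
      AdjoinRoot.of P (u (k + 1) ^ n) * z ^ (t * (n * v (k + 1))) * Ps.coeff 1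
  have hv1 : ∀ i ≤ k, v' i = q * v i := fun i hi => if_pos hi
  have hu1 : ∀ i ≤ k, u' i = AdjoinRoot.of P (u i) * z ^ (t * v i) := fun i hi => if_pos hi
  have hv2 : v' (k + 1) = q * v (k + 1) + m := by simp [v']
  have hu2 : u' (k + 1) = AdjoinRoot.of P (u (k + 1)) * z ^ (t * v (k + 1) + s) := by simp [u']
  have hv3 : v' (k + 2) = q * (n * v (k + 1)) + m * n := by simp [v']
  have hu3 : u' (k + 2) = AdjoinRoot.of P (u (k + 1) ^ n) * z ^ (t * (n * v (k + 1))) *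
    Ps.coeff 1 := by simp [u']
  have hof : ∀ i ≤ k + 1, AdjoinRoot.of P (u i) ≠ 0 := fun i hi =>
    (map_ne_zero _).2 (hI.ne_zero i hi)
  have hfalse : ∀ {v b : ℕ} {u : AdjoinRoot P} {R : (AdjoinRoot P)⟦X⟧[X]},
      MonoLead False v b u R → MonoLead (k + 1 = 0) v b u R := fun ⟨U, h1, h2, _⟩ =>
    ⟨U, h1, h2, fun h => absurd h (Nat.succ_ne_zero k)⟩
  have hmono : ∀ i ≤ k + 1, MonoLead (k + 1 = 0) (v' i) 0 (u' i) (π' (Phi φ i)) := by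
    intro i hi
    rcases Nat.lt_or_ge k i with hlt | hle
    · obtain rfl : i = k + 1 := by omega
      have := (hσ _ _ _ _ hI.mono_last).monoLead_zero
      rw [pow_one, Polynomial.coeff_C_mul, Polynomial.coeff_add, Polynomial.coeff_X_zero, zero_add,
        Polynomial.coeff_C_zero, mul_assoc, ← pow_add, mul_one] at this
      rw [hv2, hu2]
      exact hfalse this
    · have := (hσ _ _ _ _ (hI.mono i hle)).monoLead_zero
      rw [pow_zero, mul_one, Polynomial.coeff_C_zero, mul_zero, add_zero] at this
      rw [hv1 i hle, hu1 i hle]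
      exact hfalse this
  have hlast' : MonoLead (k + 1 = 0) (v' (k + 2)) 1 (u' (k + 2)) (π' (φ (k + 1))) := by
    rw [hv3, hu3]
    exact hfalse hlast
  have hfac : ∃ U, π' F = Polynomial.C (PowerSeries.X ^ (N * v' (k + 2))) * tauHom (shift G) G * U ∧
      MonoLead (k + 1 = 0) 0 0 (u' (k + 2) ^ N) U := by
    obtain ⟨U₀, hU₀, hU₀m⟩ := hI.factor
    have hlU := (hU₀m.sigmaHom (AdjoinRoot.of P) q hq m s t z hcm).tauHom hc0
    have hlQ : HasLead (tauHom (shift G) Q) 0 (Q.map PowerSeries.constantCoeff) :=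
      ⟨tauHom (shift G) Q, by simp, tauHom_map hc0 Q⟩
    have hlz : HasLead (Polynomial.C (PowerSeries.C (z ^ (t * (S.N * v (k + 1))))) :
        (AdjoinRoot P)⟦X⟧[X]) 0 (Polynomial.C (z ^ (t * (S.N * v (k + 1))))) :=
      ⟨Polynomial.C (PowerSeries.C (z ^ (t * (S.N * v (k + 1))))), by simp, by simp⟩
    refine ⟨Polynomial.C (PowerSeries.C (z ^ (t * (S.N * v (k + 1))))) * (tauHom (shift G) Q *
        tauHom (shift G) (sigmaHom (AdjoinRoot.of P) q hq m s t z U₀)), ?_, hfalse ?_⟩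
    · have h1 : sigmaHom (AdjoinRoot.of P) q hq m s t z (S.pi F) = _ := congrArg _ hU₀
      rw [map_mul, map_mul, hF', hFQ, sigmaHom_C_X_pow] at h1
      -- The two powers of x come from the prefactor of π_k^*F and from the edge of H_k; they
      -- combine because N_k = qℓN.
      have h2 : N * v' (k + 2) = q * (S.N * v (k + 1)) + q * m * P.natDegree * N := by
        rw [hv3, hdegN, hn]; ring
      rw [hπ', RingHom.comp_apply, RingHom.comp_apply, h1, h2, pow_add, Polynomial.C_mul]
      simp only [map_mul (tauHom (shift G)), tauHom_C]
      ring
    · have h1 := (hlz.mul (hlQ.mul hlU)).monoLead_zero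
      have h2 : (Polynomial.C (z ^ (t * (S.N * v (k + 1)))) * (Q.map PowerSeries.constantCoeff *
          (Polynomial.C (AdjoinRoot.of P (u (k + 1) ^ S.N) * z ^ (t * 0)) *
            (Polynomial.X + Polynomial.C (z ^ s)) ^ 0))).coeff 0 = u' (k + 2) ^ N := by
        rw [Polynomial.coeff_C_mul, Polynomial.mul_coeff_zero, Polynomial.coeff_map, hQN, pow_zero,
          mul_one, Polynomial.coeff_C_zero, hu3, hdegN, mul_pow, mul_pow, ← pow_mul, ← map_pow,
          ← pow_mul, mul_zero, pow_zero, mul_one,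
          show t * (n * N * v (k + 1)) = t * (n * v (k + 1)) * N by ring]
        ring
      rw [h2] at h1
      simpa only [mul_zero, add_zero] using h1
  refine ⟨v', u', ?_⟩
  refine
    { perfect := ?_
      mono := ?_
      mono_last := ?_
      ne_zero := ?_
      v_zero := ?_
      pi_C := ?_
      small := ?_
      factor := ?_
      monic := ?_
      natDegree_eq := ?_
      map_eq := ?_
      N_ne_zero := hNK
      indep := ?_ }
  · have : Module.Finite S.L (AdjoinRoot P) := hE.monic.finite_adjoinRoot
    exact Algebra.IsAlgebraic.perfectField S.L (L := AdjoinRoot P)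
  · intro i hi
    exact hmono i hi
  · exact hlast'
  · intro i hi
    change u' i ≠ 0
    rcases Nat.lt_or_ge k i with hlt | hle
    · rcases Nat.lt_or_ge (k + 1) i with hlt' | hle'
      · obtain rfl : i = k + 2 := by omega
        rw [hu3]
        refine mul_ne_zero (mul_ne_zero ?_ (pow_ne_zero _ hz0)) hPs1
        rw [map_pow]
        exact pow_ne_zero _ (hof _ le_rfl)
      · obtain rfl : i = k + 1 := by omega
        rw [hu2]
        exact mul_ne_zero (hof _ le_rfl) (pow_ne_zero _ hz0)
    · rw [hu1 i hle]
      exact mul_ne_zero (hof _ (by omega)) (pow_ne_zero _ hz0)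
  · rw [hv1 0 (Nat.zero_le k)]
    exact Nat.mul_pos hq0 hI.v_zero
  · intro a
    change tauHom (shift G) (sigmaHom (AdjoinRoot.of P) q hq m s t z (S.pi _)) =
      Polynomial.C (PowerSeries.C (AdjoinRoot.of P (S.ι a)))
    rw [hI.pi_C, sigmaHom_C_C, tauHom_C]
  · intro A hA hdeg
    rw [hdφ] at hdeg
    obtain ⟨v₁, u₁, hu₁, h₁⟩ := exists_monoLead_next hφ.monic hE.coeff_zero hq0 hst hσ
      hI.mono_last (hI.ne_zero _ le_rfl) hI.small hA hdeg
    exact ⟨v₁, u₁, hu₁, hfalse h₁⟩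
  · exact hfac
  · change (tauHom (shift G) G).Monic
    rw [tauHom_eq_taylor]; exact hGm.comp_X_add_C _
  · change (tauHom (shift G) G).natDegree = N
    rw [tauHom_eq_taylor, Polynomial.natDegree_taylor, hGN]
  · intro _
    change (tauHom (shift G) G).map PowerSeries.constantCoeff = Polynomial.X ^ N
    rw [tauHom_map hc0, hGmap, hGN]
  · refine Indep.next hI.indep (by omega) (hI.ne_zero _ le_rfl) hE.coeff_zero hq0 hst hr
      (fun i hi => hv1 i (by omega)) hv2 (fun i hi => hu1 i (by omega)) hu2

theorem exists_invariant {K : Type u} [Field K] [PerfectField K] {F : K⟦X⟧[X]} (hF : F.Monic)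
    (hd : (F.natDegree : K) ≠ 0) {k : ℕ} {S : ℕ → Stage K} (hS : IsRun F k S) {φ : ℕ → K⟦X⟧[X]}
    (hφ : ∀ i ≤ k, IsMinimalPoly (S i) (φ i)) : ∀ i ≤ k, ∃ (v : ℕ → ℕ) (u : ℕ → (S i).L),
      Invariant F i (S i) φ (fun i => (S i).q * (S i).ell) v u := by
  intro i
  induction i with
  | zero =>
    intro _
    have h0 := hφ 0 (Nat.zero_le k)
    -- The type of u depends on the stage, so the bounds and the stage are generalised before
    -- substituting the initial stage.
    generalize (fun i => (S i).q * (S i).ell) = r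
    have h1 := hS.1
    generalize S 0 = S₀ at h0 h1 ⊢
    subst h1
    exact ⟨_, _, invariant_init hF hd h0 r⟩
  | succ i ih =>
    intro hi
    obtain ⟨v, u, hI⟩ := ih (by omega)
    exact invariant_next hI (hS.2 i (by omega)) (hφ i (by omega)) (hφ (i + 1) hi) rfl

/-! ### Comparison of the expansion with the boundary. -/

/-- The last exponent is unbounded, hence outside the scope of `Indep`. Being constant on T, it only
contributes a common factor Λ_n^b. -/
theorem Indep.sum_ne_zero {K L : Type u} [Field K] [Field L] {ι : K →+* L} {r : ℕ → ℕ} {n : ℕ}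
    {V : ℕ → ℕ} {Λ : ℕ → L} (h : Indep ι r n V Λ) (hΛ : Λ n ≠ 0) {J b : ℕ}
    (T : Finset (Fin (n + 1) → ℕ)) (f : (Fin (n + 1) → ℕ) → K)
    (hT : ∀ B ∈ T, ∀ i : Fin (n + 1), 1 ≤ (i : ℕ) → (i : ℕ) < n → B i < r i)
    (hJ : ∀ B ∈ T, ∑ i : Fin (n + 1), B i * V i = J) (hb : ∀ B ∈ T, B (Fin.last n) = b)
    {B : Fin (n + 1) → ℕ} (hB : B ∈ T) (hf : f B ≠ 0) :
    ∑ B ∈ T, ι (f B) * ∏ i : Fin (n + 1), Λ i ^ B i ≠ 0 := by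
  classical
  intro hsum
  have hsn : ∀ B' ∈ T, (Fin.snoc (α := fun _ => ℕ) (Fin.init B') b : Fin (n + 1) → ℕ) = B' := by
    intro B' hB'
    rw [← hb B' hB']
    exact Fin.snoc_init_self B'
  have hinj : Set.InjOn (Fin.init (α := fun _ => ℕ)) (T : Set (Fin (n + 1) → ℕ)) := by
    intro B₁ h₁ B₂ h₂ h12
    rw [← hsn B₁ h₁, ← hsn B₂ h₂, h12]
  have hw : ∀ B' ∈ T, (∑ i : Fin n, B' i.castSucc * V i) + b * V n = J := by
    intro B' hB'
    rw [← hJ B' hB', Fin.sum_univ_castSucc, hb B' hB']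
    rfl
  have := h (∑ i : Fin n, B i.castSucc * V i) (T.image (Fin.init (α := fun _ => ℕ)))
    (fun B' => f (Fin.snoc (α := fun _ => ℕ) B' b)) ?_ ?_ ?_ _ (Finset.mem_image_of_mem _ hB)
  · rw [hsn B hB] at this
    exact hf this
  · intro B' hB' i hi
    obtain ⟨B₁, h₁, rfl⟩ := Finset.mem_image.1 hB'
    exact hT B₁ h₁ i.castSucc hi i.2
  · intro B' hB'
    obtain ⟨B₁, h₁, rfl⟩ := Finset.mem_image.1 hB'
    exact Nat.add_right_cancel ((hw B₁ h₁).trans (hw B hB).symm)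
  · rw [Finset.sum_image hinj]
    refine (mul_eq_zero.1 ?_).resolve_right (pow_ne_zero b hΛ)
    rw [Finset.sum_mul, ← hsum]
    refine Finset.sum_congr rfl fun B' hB' => ?_
    rw [hsn B' hB', Fin.prod_univ_castSucc, hb B' hB', mul_assoc]
    rfl

section Product

variable {L : Type u} [Field L] {c : Prop} {μ : L} {H U : L⟦X⟧[X]} {w : ℕ}

theorem coeff_coeff_mul (H U : L⟦X⟧[X]) (i j : ℕ) : PowerSeries.coeff j ((H * U).coeff i) =
    ∑ a ∈ Finset.HasAntidiagonal.antidiagonal i, ∑ b ∈ Finset.HasAntidiagonal.antidiagonal j,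
      PowerSeries.coeff b.1 (H.coeff a.1) * PowerSeries.coeff b.2 (U.coeff a.2) := by
  rw [Polynomial.coeff_mul, map_sum]
  exact Finset.sum_congr rfl fun a _ => PowerSeries.coeff_mul _ _ _

theorem exists_coeff_ne_zero_of_mul (hU : MonoLead c 0 0 μ U) {i J : ℕ}
    (h : PowerSeries.coeff J ((Polynomial.C (PowerSeries.X ^ w) * H * U).coeff i) ≠ 0) :
    ∃ i' j', PowerSeries.coeff j' (H.coeff i') ≠ 0 ∧ w + j' ≤ J ∧ i' ≤ i ∧ (c → i' = i) := by
  rw [mul_assoc, Polynomial.coeff_C_mul, PowerSeries.coeff_X_pow_mul'] at h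
  split_ifs at h with hwJ
  · rw [coeff_coeff_mul] at h
    obtain ⟨a, ha, h⟩ := Finset.exists_ne_zero_of_sum_ne_zero h
    obtain ⟨b, hb, h⟩ := Finset.exists_ne_zero_of_sum_ne_zero h
    have h2 := hU.le_of_coeff_ne_zero (right_ne_zero_of_mul h)
    rw [Finset.HasAntidiagonal.mem_antidiagonal] at ha hb
    refine ⟨a.1, b.1, left_ne_zero_of_mul h, by omega, by omega, fun hc => ?_⟩
    have := h2.2.2 hc
    omega
  · exact absurd rfl h

/-- By minimality of (i, j) among the exponents of H, the convolution with U has a single possibly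
nonzero term, where U contributes U(0,0). -/
theorem coeff_mul_of_mem_newtonPolygon (hU : MonoLead c 0 0 μ U) (hH : H.Monic)
    (hc : ¬ c → H.map PowerSeries.constantCoeff = Polynomial.X ^ H.natDegree) {i j : ℕ}
    (hN : ((i : ℝ), (j : ℝ)) ∈ newtonPolygon H) :
    PowerSeries.coeff (w + j) ((Polynomial.C (PowerSeries.X ^ w) * H * U).coeff i) =
      PowerSeries.coeff j (H.coeff i) * μ := by
  have key : ∀ a ∈ Finset.HasAntidiagonal.antidiagonal i, ∀ b ∈ Finset.HasAntidiagonal.antidiagonal j,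
      PowerSeries.coeff b.1 (H.coeff a.1) * PowerSeries.coeff b.2 (U.coeff a.2) ≠ 0 →
        a = (i, 0) ∧ b = (j, 0) := by
    intro a ha b hb h
    have h2 := hU.le_of_coeff_ne_zero (right_ne_zero_of_mul h)
    rw [Finset.HasAntidiagonal.mem_antidiagonal] at ha hb
    have h3 := eq_of_le_of_mem_newtonPolygon hH hc hN (left_ne_zero_of_mul h) (by omega) (by omega)
      (fun hc => by have := h2.2.2 hc; omega)
    exact ⟨Prod.ext h3.1 (by dsimp only; omega), Prod.ext h3.2 (by dsimp only; omega)⟩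
  rw [mul_assoc, Polynomial.coeff_C_mul, PowerSeries.coeff_X_pow_mul', if_pos (Nat.le_add_right _ _),
    Nat.add_sub_cancel_left, coeff_coeff_mul, Finset.sum_eq_single (i, 0),
    Finset.sum_eq_single (j, 0), hU.coeff]
  · intro b hb hne
    by_contra h
    exact hne (key (i, 0) (by simp) b hb h).2
  · intro h; simp at h
  · intro a ha hne
    refine Finset.sum_eq_zero fun b hb => ?_
    by_contra h
    exact hne (key a ha b hb h).1
  · intro h; simp at h

end Product

/-- Comparison of the expansion of `R = x ^ w H U` in terms with monomial leading parts and
linearly independent leading coefficients with the boundary of `H`. -/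
theorem coeff_eq_sum_of_mem_newtonPolygon {K L : Type u} [Field K] [Field L] {ι : K →+* L}
    {r : ℕ → ℕ} {n : ℕ} {V : ℕ → ℕ} {Λ : ℕ → L} (hind : Indep ι r n V Λ) (hΛ : Λ n ≠ 0)
    (hV : 0 < V 0) {c : Prop} {μ : L} {R H U : L⟦X⟧[X]} {w : ℕ}
    (hR : R = Polynomial.C (PowerSeries.X ^ w) * H * U)
    (hU : MonoLead c 0 0 μ U) (hH : H.Monic)
    (hc : ¬ c → H.map PowerSeries.constantCoeff = Polynomial.X ^ H.natDegree)
    {f : (Fin (n + 1) → ℕ) → K}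
    (hf : ∀ B, f B ≠ 0 → ∀ i : Fin (n + 1), 1 ≤ (i : ℕ) → (i : ℕ) < n → B i < r i)
    {M : (Fin (n + 1) → ℕ) → L⟦X⟧[X]}
    (hM : ∀ B, MonoLead c (∑ i : Fin (n + 1), B i * V i) (B (Fin.last n))
      (∏ i : Fin (n + 1), Λ i ^ B i) (M B))
    (hexp : ∀ J, ∃ T : Finset (Fin (n + 1) → ℕ), (∀ B, B ∈ T ↔ f B ≠ 0 ∧ B 0 < J + 1) ∧
      ∀ i, PowerSeries.coeff J (R.coeff i) =
        ∑ B ∈ T, ι (f B) * PowerSeries.coeff J ((M B).coeff i))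
    {i j : ℕ} (hN : ((i : ℝ), (j : ℝ)) ∈ newtonPolygon H) :
    (∀ B, f B ≠ 0 → B (Fin.last n) = i → w + j ≤ ∑ i : Fin (n + 1), B i * V i) ∧
    ∃ T : Finset (Fin (n + 1) → ℕ),
      (∀ B, B ∈ T ↔ f B ≠ 0 ∧ ∑ i : Fin (n + 1), B i * V i = w + j ∧ B (Fin.last n) = i) ∧
      PowerSeries.coeff j (H.coeff i) * μ =
        ∑ B ∈ T, ι (f B) * ∏ i : Fin (n + 1), Λ i ^ B i := by
  classical
  set val : (Fin (n + 1) → ℕ) → ℕ := fun B => ∑ i : Fin (n + 1), B i * V i with hval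
  -- Since V 0 ≥ 1, truncating at b_{-1} ≤ J loses no B of value at most J.
  have hB0 : ∀ B, B 0 ≤ val B := fun B =>
    (Nat.le_mul_of_pos_right _ hV).trans
      (Finset.single_le_sum (f := fun i : Fin (n + 1) => B i * V i) (fun _ _ => Nat.zero_le _)
        (Finset.mem_univ 0))
  have hmin : ∀ i J, (∀ B, f B ≠ 0 → val B ≤ J → B (Fin.last n) ≤ i → (c → B (Fin.last n) = i) →
      val B = J ∧ B (Fin.last n) = i) → ∃ T : Finset (Fin (n + 1) → ℕ),
      (∀ B, B ∈ T ↔ f B ≠ 0 ∧ val B = J ∧ B (Fin.last n) = i) ∧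
      PowerSeries.coeff J (R.coeff i) = ∑ B ∈ T, ι (f B) * ∏ i : Fin (n + 1), Λ i ^ B i := by
    intro i J hm
    obtain ⟨T, hT, hsum⟩ := hexp J
    refine ⟨T.filter fun B => val B = J ∧ B (Fin.last n) = i, fun B => ?_, ?_⟩
    · rw [Finset.mem_filter, hT]
      refine ⟨fun h => ⟨h.1.1, h.2⟩, fun h => ⟨⟨h.1, ?_⟩, h.2⟩⟩
      have := hB0 B
      rw [h.2.1] at this
      omega
    · rw [hsum, Finset.sum_filter]
      refine Finset.sum_congr rfl fun B hB => ?_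
      split_ifs with h
      · rw [← (hM B).coeff, h.2]
        congr 3
        exact h.1.symm
      · by_contra hne
        have h1 := (hM B).le_of_coeff_ne_zero (right_ne_zero_of_mul hne)
        exact h (hm B ((hT B).1 hB).1 h1.1 h1.2.1 h1.2.2)
  have hclaim : ∀ B, f B ≠ 0 → val B ≤ w + j → B (Fin.last n) ≤ i → (c → B (Fin.last n) = i) →
      val B = w + j ∧ B (Fin.last n) = i := by
    intro B h1 h2 h3 h4
    -- Choose B₁ minimising value plus last exponent among the B under consideration. Its
    -- coefficient in R is nonzero by independence, so H has an exponent at or below it, which must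
    -- be (i, j). Thus the minimum is already w + j + i.
    have hex : ∃ N, ∃ B, (f B ≠ 0 ∧ val B ≤ w + j ∧ B (Fin.last n) ≤ i ∧ (c → B (Fin.last n) = i)) ∧
        val B + B (Fin.last n) = N := ⟨_, B, ⟨h1, h2, h3, h4⟩, rfl⟩
    obtain ⟨B₁, ⟨g1, g2, g3, g4⟩, g5⟩ := Nat.find_spec hex
    have hle : ∀ B, f B ≠ 0 → val B ≤ w + j → B (Fin.last n) ≤ i → (c → B (Fin.last n) = i) →
        val B₁ + B₁ (Fin.last n) ≤ val B + B (Fin.last n) := fun B k1 k2 k3 k4 => by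
      rw [g5]; exact Nat.find_min' hex ⟨B, ⟨k1, k2, k3, k4⟩, rfl⟩
    obtain ⟨T, hT, hcoeff⟩ := hmin (B₁ (Fin.last n)) (val B₁) fun B k1 k2 k3 k4 => by
      have := hle B k1 (k2.trans g2) (k3.trans g3) fun hc => (k4 hc).trans (g4 hc)
      omega
    have hne := hind.sum_ne_zero hΛ T f (fun B hB => hf B ((hT B).1 hB).1)
      (fun B hB => ((hT B).1 hB).2.1) (fun B hB => ((hT B).1 hB).2.2)
      ((hT B₁).2 ⟨g1, rfl, rfl⟩) g1
    rw [← hcoeff, hR] at hne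
    obtain ⟨i', j', k1, k2, k3, k4⟩ := exists_coeff_ne_zero_of_mul hU hne
    have h5 := eq_of_le_of_mem_newtonPolygon hH hc hN k1 (by omega) (by omega)
      fun hc => (k4 hc).trans (g4 hc)
    have h6 := hle B h1 h2 h3 h4
    omega
  refine ⟨fun B h1 h2 => ?_, ?_⟩
  · by_contra! hlt
    have := hclaim B h1 hlt.le h2.le fun _ => h2
    exact hlt.ne this.1
  · obtain ⟨T, hT, hcoeff⟩ := hmin i (w + j) hclaim
    refine ⟨T, hT, ?_⟩
    rw [← hcoeff, hR, coeff_mul_of_mem_newtonPolygon hU hH hc hN]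

/-! ### Values of v_k, λ_k and Λ^B. -/

namespace Invariant

variable {K : Type u} [Field K] {F : K⟦X⟧[X]} {k : ℕ} {S : Stage K}
    {φ : ℕ → K⟦X⟧[X]} {r v : ℕ → ℕ} {u : ℕ → S.L}

theorem stage_v (h : Invariant F k S φ r v u) {i : ℕ} (hi : i ≤ k + 1) :
    S.v (Phi φ i) = v i := by
  rcases hi.eq_or_lt with rfl | hlt
  · exact h.mono_last.xval (h.ne_zero _ le_rfl)
  · exact (h.mono i (by omega)).xval (h.ne_zero _ hi)

theorem stage_lam (h : Invariant F k S φ r v u) {i : ℕ} (hi : i ≤ k + 1) :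
    S.lam (Phi φ i) = u i := by
  rw [Stage.lam, h.stage_v hi, ENat.toNat_natCast]
  rcases hi.eq_or_lt with rfl | hlt
  · exact h.mono_last.trailingCoeff_xcoeff (h.ne_zero _ le_rfl)
  · exact (h.mono i (by omega)).trailingCoeff_xcoeff (h.ne_zero _ hi)

theorem pairing_eq (h : Invariant F k S φ r v u) (B : Fin (k + 2) → ℕ) :
    pairing S φ B = ((∑ i : Fin (k + 2), B i * v i : ℕ) : ℕ∞) := by
  rw [pairing]
  push_cast
  refine Finset.sum_congr rfl fun i _ => ?_
  rw [h.stage_v (by omega)]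

theorem monoLead_phiPow (h : Invariant F k S φ r v u) (B : Fin (k + 2) → ℕ) :
    MonoLead (k = 0) (∑ i : Fin (k + 2), B i * v i) (B (Fin.last (k + 1)))
      (∏ i : Fin (k + 2), u i ^ B i) (S.pi (phiPow φ B)) := by
  rw [phiPow, Fin.prod_univ_castSucc (fun i : Fin (k + 2) => Phi φ i ^ B i), map_mul, map_prod,
    Fin.sum_univ_castSucc,
    Fin.prod_univ_castSucc (fun i : Fin (k + 2) => u i ^ B i)]
  have h1 := MonoLead.prod (c := k = 0) Finset.univ (fun i : Fin (k + 1) => B i.castSucc * v i)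
    (fun _ => 0) (fun i => u i ^ B i.castSucc) (fun i => S.pi (Phi φ i ^ B i.castSucc))
    (fun i _ => by
      rw [map_pow]
      simpa using (h.mono i (by omega)).pow (B i.castSucc))
  have h2 := h.mono_last.pow (B (Fin.last (k + 1)))
  rw [← map_pow] at h2
  simpa [Phi] using h1.mul h2

theorem stage_v_F (h : Invariant F k S φ r v u) : S.v F = ((S.N * v (k + 1) : ℕ) : ℕ∞) := by
  obtain ⟨U, hU, hm⟩ := h.factor
  have hl : HasLead (S.pi F) (S.N * v (k + 1))
      ((S.H * U).map PowerSeries.constantCoeff) := ⟨S.H * U, by rw [hU, mul_assoc], rfl⟩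
  refine hl.xval ?_
  rw [Polynomial.map_mul]
  refine mul_ne_zero (h.monic.map _).ne_zero fun h0 => ?_
  have h1 := congrArg (fun p => p.coeff 0) h0
  simp only [Polynomial.coeff_map, Polynomial.coeff_zero] at h1
  have h2 := hm.coeff
  rw [PowerSeries.coeff_zero_eq_constantCoeff_apply, h1] at h2
  exact pow_ne_zero _ (h.ne_zero _ le_rfl) h2.symm

theorem lamPow_eq (h : Invariant F k S φ r v u) (B : Fin (k + 2) → ℕ) :
    lamPow S φ (fun i => (B i : ℤ) - (baseVec k S.N i : ℤ)) =
      (∏ i : Fin (k + 2), u i ^ B i) * (u (k + 1) ^ S.N)⁻¹ := by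
  have h1 : ∀ i : Fin (k + 2), S.lam (Phi φ i) ^ ((B i : ℤ) - (baseVec k S.N i : ℤ)) =
      u i ^ B i * (u i ^ baseVec k S.N i)⁻¹ := fun i => by
    rw [h.stage_lam (by omega), zpow_sub₀ (h.ne_zero _ (by omega)), zpow_natCast, zpow_natCast,
      div_eq_mul_inv]
  rw [lamPow, Finset.prod_congr rfl fun i _ => h1 i, Finset.prod_mul_distrib]
  congr 1
  rw [Finset.prod_eq_single (Fin.last (k + 1))]
  · simp [baseVec]
  · intro i _ hi
    simp [baseVec, Pi.single_eq_of_ne hi]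
  · simp

/-- The pull-back of x^(J+1) is divisible by x^(v_0(J+1)) with v_0 ≥ 1, so the x-adic remainder does
not affect the coefficient of x^J. -/
theorem coeff_eq_sum {f : (Fin (k + 2) → ℕ) → K} (h : Invariant F k S φ r v u)
    {S' : ℕ → Stage K} (hf : IsPhiExpansion S' k φ F f) (J : ℕ) :
    ∃ T : Finset (Fin (k + 2) → ℕ), (∀ B, B ∈ T ↔ f B ≠ 0 ∧ B 0 < J + 1) ∧
      ∀ i, PowerSeries.coeff J ((S.pi F).coeff i) =
        ∑ B ∈ T, S.ι (f B) * PowerSeries.coeff J ((S.pi (phiPow φ B)).coeff i) := by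
  obtain ⟨T, hT, D, hD⟩ := hf.2 (J + 1)
  refine ⟨T, hT, fun i => ?_⟩
  obtain ⟨A, hA, -⟩ := h.mono 0 (Nat.zero_le k)
  have hX : S.pi (Polynomial.C (PowerSeries.X ^ (J + 1))) =
      Polynomial.C (PowerSeries.X ^ (v 0 * (J + 1))) * A ^ (J + 1) := by
    rw [Polynomial.C_pow, map_pow]
    change S.pi (Phi φ 0) ^ (J + 1) = _
    rw [hA, pow_zero, mul_one, mul_pow, ← Polynomial.C_pow, ← pow_mul]
  rw [sub_eq_iff_eq_add] at hD
  rw [hD, map_add, map_mul, hX, Polynomial.coeff_add, map_add, mul_assoc, Polynomial.coeff_C_mul,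
    PowerSeries.coeff_X_pow_mul', if_neg (by nlinarith [h.v_zero]), zero_add, map_sum,
    Polynomial.finsetSum_coeff, map_sum]
  refine Finset.sum_congr rfl fun B _ => ?_
  rw [map_mul, h.pi_C, Polynomial.coeff_C_mul, PowerSeries.coeff_C_mul]

end Invariant

end ARNP

/-! ### The boundary polynomial of H_k. -/

theorem mainTheorem7 {K : Type u} [Field K] [PerfectField K] (F : K⟦X⟧[X])
    (hF : F.Monic) (hd : 0 < F.natDegree)
    (hchar : ringChar K = 0 ∨ F.natDegree < ringChar K)
    (k : ℕ) (S : ℕ → ARNP.Stage K) (hS : ARNP.IsRun F k S)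
    (φ : ℕ → K⟦X⟧[X]) (hφ : ∀ i ≤ k, ARNP.IsMinimalPoly (S i) (φ i))
    (f : (Fin (k + 2) → ℕ) → K) (hf : ARNP.IsPhiExpansion S k φ F f) :
    ARNP.boundaryPoly (S k).H =
      ∑ᶠ p ∈ {p : ℕ × ℕ | ((p.1 : ℝ), (p.2 : ℝ)) ∈ ARNP.newtonPolygon (S k).H ∧
          ARNP.IsWeight (S k) φ F f p.1 p.2},
        Polynomial.monomial p.1 (Polynomial.monomial p.2
          (∑ᶠ B ∈ ARNP.levelSet S k φ p.1 ((p.2 : ℕ∞) + (S k).v F),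
            (S k).ι (f B) * ARNP.lamPow (S k) φ
              (fun i => (B i : ℤ) - (ARNP.baseVec k (S k).N i : ℤ)))) := by
  classical
  have hdK : (F.natDegree : K) ≠ 0 := fun h => by
    have hdvd := ringChar.dvd h
    rcases hchar with h0 | hlt
    · rw [h0, zero_dvd_iff] at hdvd
      omega
    · exact absurd (Nat.le_of_dvd hd hdvd) (by omega)
  obtain ⟨v, u, hI⟩ := ARNP.exists_invariant hF hdK hS hφ k le_rfl
  obtain ⟨U, hU, hUm⟩ := hI.factor
  set w := (S k).N * v (k + 1) with hw
  set μ := u (k + 1) ^ (S k).N with hμ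
  have hμ0 : μ ≠ 0 := pow_ne_zero _ (hI.ne_zero _ le_rfl)
  have hlev : ∀ (i j : ℕ) B, f B ≠ 0 →
      (B ∈ ARNP.levelSet S k φ i ((j : ℕ∞) + (S k).v F) ↔
        ∑ i : Fin (k + 2), B i * v i = w + j ∧ B (Fin.last (k + 1)) = i) := by
    intro i j B hB
    simp only [ARNP.levelSet, Set.mem_ofPred_eq]
    rw [hI.pairing_eq, hI.stage_v_F, ← Nat.cast_add, Nat.cast_inj, add_comm j]
    exact ⟨fun h => ⟨h.2.2, h.2.1⟩, fun h => ⟨hf.1 B hB, h.2, h.1⟩⟩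
  rw [ARNP.boundaryPoly, finsum_mem_def, finsum_mem_def]
  refine finsum_congr fun p => ?_
  obtain ⟨i, j⟩ := p
  by_cases hN : ((i : ℝ), (j : ℝ)) ∈ ARNP.newtonPolygon (S k).H
  swap
  · rw [Set.indicator_of_notMem (by exact fun h => hN h),
      Set.indicator_of_notMem (by exact fun h => hN h.1)]
  obtain ⟨hle, T, hT, hsum⟩ := ARNP.coeff_eq_sum_of_mem_newtonPolygon hI.indep
    (hI.ne_zero _ le_rfl) hI.v_zero hU hUm hI.monic
    (fun hk => by rw [hI.natDegree_eq]; exact hI.map_eq hk)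
    (fun B hB i h1 h2 => hf.1 B hB i h1 (by omega)) hI.monoLead_phiPow
    (hI.coeff_eq_sum hf) hN
  rw [Set.indicator_of_mem (by exact hN)]
  by_cases hW : ARNP.IsWeight (S k) φ F f i j
  · rw [Set.indicator_of_mem (by exact ⟨hN, hW⟩)]
    congr 2
    dsimp only
    -- T is the part of the level set with f_B ≠ 0, so the inner sum is finite.
    rw [finsum_mem_eq_sum_of_inter_support_eq (t := T)]
    · rw [Finset.sum_congr rfl fun B _ => by rw [hI.lamPow_eq B, ← mul_assoc],
        ← Finset.sum_mul, ← hsum, mul_inv_cancel_right₀ hμ0]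
    · ext B
      refine and_congr_left fun hB => ?_
      have hfB : f B ≠ 0 := fun h => hB (by simp [h])
      rw [hlev i j B hfB, Finset.mem_coe, hT]
      exact ⟨fun h => ⟨hfB, h⟩, fun h => h.2⟩
  · rw [Set.indicator_of_notMem (by exact fun h => hW h.2)]
    -- An element of T would attain the lower bound `hle`, making j the weight w_i. So off the
    -- weights the coefficient of H_k is zero.
    have hT0 : T = ∅ := by
      rw [Finset.eq_empty_iff_forall_notMem]
      intro B hB
      obtain ⟨h1, h2, h3⟩ := (hT B).1 hB
      refine hW ?_
      rw [ARNP.IsWeight, ARNP.minPairing, hI.stage_v_F, ← Nat.cast_add, add_comm j]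
      refine le_antisymm (sInf_le ⟨B, h3, h1, ?_⟩) (le_sInf ?_)
      · rw [hI.pairing_eq, h2]
      · rintro _ ⟨B', g1, g2, rfl⟩
        rw [hI.pairing_eq]
        exact_mod_cast hle B' g2 g1
    rw [hT0, Finset.sum_empty] at hsum
    have h0 := (mul_eq_zero.1 hsum).resolve_right hμ0
    dsimp only
    rw [h0, map_zero, map_zero]
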